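/- **Setting.** Let $\Omega$ be a finite state space, $\mathbb{D}\Omega\subseteq\mathbb{R}^\Omega$ its set of probability distributions, $\delta_s$ the point distribution at $s$, and $\mu(O)=\sum_{s\in O}\mu(s)$. An *atomic action* is a map $r$ sending each $s\in\Omega$ to a closed convex (possibly empty) set $r(s)\subseteq\mathbb{D}\Omega$; it is a *program* if every $r(s)$ is nonempty. Write $r\sqsubseteq r'$ if $r(s)\subseteq r'(s)$ for all $s$; $\delta(s)=\{\delta_s\}$; $(r\cap r')(s)=r(s)\cap r'(s)$; $(r+r')(s)=\{(1-p)\mu+p\mu' : p\in[0,1],\ \mu\in r(s),\ \mu'\in r'(s)\}$. **Event structures.** A *bundle event structure with internal probability* (ipBES) $\mathcal{E}=(E,\mapsto,\#,\lambda,\Phi)$ consists of a set $E$ of events, an irreflexive symmetric conflict relation $\#$ on $E$, a bundle relation $\mapsto$ between subsets of $E$ and events, a labelling $\lambda$ of events by atomic actions, and a family $\Phi$ of subsets of $E$ (final sets), where distinct events of a bundle, or of a final set, are in conflict. The initial events are those to which no bundle points. A *trace* is a finite sequence of events $e_1\cdots e_n$ such that each $e_j$ is different from and not in conflict with $e_1,\dots,e_{j-1}$,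 and each bundle $x\mapsto e_j$ contains some $e_i$ with $i<j$. A trace is *maximal* if it has no proper extension to a trace, and *weakly maximal* if it can be extended to a maximal trace by a (possibly empty) sequence of events $e$ with $\delta\sqsubseteq\lambda(e)$. **Operations** (on structures with disjoint event sets). * A program $r$ is identified with the structure with one event $e$, labelled $r$, and $\Phi=\{\{e\}\}$; $1$ is the structure of $\delta$. * $\mathcal{E}\|\mathcal{F}$ is the union of the two structures, componentwise. * $\mathcal{E}\cdot\mathcal{F}$ is the union, with the additional bundles $x\mapsto e$ for $x\in\Phi_{\mathcal{E}}$ and $e$ initial in $\mathcal{F}$, and with final sets $\Phi_{\mathcal{F}}$. * $\mathcal{E}+\mathcal{F}$ is the union, with the additional conflicts between the initial events of $\mathcal{E}$ and those of $\mathcal{F}$ and between the members of final sets of $\mathcal{E}$ and those of final sets of $\mathcal{F}$, and with final sets $x\cup y$, $x\in\Phi_{\mathcal{E}}$, $y\in\Phi_{\mathcal{F}}$. * $\mathcal{E}*\mathcal{F}$ is the limit of the increasing sequence $\mathcal{F},\ \mathcal{F}+\mathcal{E}\cdot\mathcal{F},\ \mathcal{F}+\mathcal{E}\cdot(\mathcal{F}+\mathcal{E}\cdot\mathcal{F}),\dots$,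 and $r^*=r*1$ for a program, or a pointwise intersection of programs, $r$. **Sequential semantics.** A *scheduler* $\sigma$ of $\mathcal{E}$ gives, for every trace $\alpha$, every event $e$ such that $\alpha e$ is a trace and every $t\in\Omega$, a subdistribution $\sigma(\alpha)(e,t)$, such that for every $\alpha$ there are weights $w(e,t)\in[0,1]$ with: $\sigma(\alpha)(e,t)=w(e,t)\mu$ for some $\mu\in\lambda(e)(t)$ if $\lambda(e)(t)\ne\emptyset$; $w(e,t)=0$ and $\sigma(\alpha)(e,t)=0$ if $\lambda(e)(t)=\emptyset$; and, if $\alpha$ is not maximal, $\sum_{e:\,\alpha e\text{ trace}}w(e,t)=1$ for every $t$. The run from $s$ is given by $\varphi(\emptyset)=\delta_s$ and $\varphi(\alpha e)(u)=\sum_{t}\sigma(\alpha)(e,t)(u)\,\varphi(\alpha)(t)$, and $\sigma_s(\mathcal{E})=\sum_{\alpha\text{ maximal}}\varphi(\alpha)$. Let $\mathbf{Sched}_1(\mathcal{E})$ be the set of the schedulers for which $\sigma_s(\mathcal{E})$ is a distribution for every $s$. Define $[\![\mathcal{E}]\!](s)$ to be the topological closure of the convex hull of $\{\sigma_s(\mathcal{E}):\sigma\in\mathbf{Sched}_1(\mathcal{E})\}$,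 and write $[\![\mathcal{E}]\!](s)(O)\ge p$ if $\mu(O)\ge p$ for every $\mu\in[\![\mathcal{E}]\!](s)$. **Simulation.** Write $\mathcal{E}\sqsubseteq_{\mathrm{sim}}\mathcal{F}$ if there is a function $f$ from the traces of $\mathcal{E}$ to the traces of $\mathcal{F}$, with finite fibres and $f(\emptyset)=\emptyset$, such that for every trace $\alpha e$ of $\mathcal{E}$ either $f(\alpha e)=f(\alpha)$ and $\lambda(e)\sqsubseteq\delta$, or $f(\alpha e)=f(\alpha)e'$ for some event $e'$ of $\mathcal{F}$ with $\lambda(e)\sqsubseteq\lambda(e')$; and, if $\alpha e$ is maximal, the second alternative holds and $f(\alpha e)$ is weakly maximal. **Proposition.** Let $\mathcal{E}_1,\mathcal{E}_2$ be ipBES over $\Omega$, let $r_1,r_2,g,g'$ be programs, $s_0\in\Omega$, $O_1,O_2\subseteq\Omega$ and $p_1,p_2\in\mathbb{R}$. Suppose that $$[\![r_1^*\|\mathcal{E}_1]\!](s_0)(O_1)\ge p_1,\qquad [\![r_2^*\|\mathcal{E}_2]\!](s_0)(O_2)\ge p_2,$$ $$\mathcal{E}_1\sqsubseteq_{\mathrm{sim}}g^*\sqsubseteq_{\mathrm{sim}}r_2^*,\qquad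 \mathcal{E}_2\sqsubseteq_{\mathrm{sim}}g'^*\sqsubseteq_{\mathrm{sim}}r_1^*.$$ Then $$[\![(r_1\cap r_2)^*\|\mathcal{E}_1\|\mathcal{E}_2]\!](s_0)(O_1\cap O_2)\ge p_1+p_2-1\qquad\text{and}\qquad \mathcal{E}_1\|\mathcal{E}_2\sqsubseteq_{\mathrm{sim}}(g+g')^*.$$ -/

import Mathlib

namespace RelyGuarantee

/-! ## Probabilistic programs on a finite state space -/

section Programs

variable {Ω : Type*} [Fintype Ω]

open Classical in
/-- The point distribution at `s`.  Distributions on the finite set `Ω` are the elements of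
`stdSimplex ℝ Ω`. -/
noncomputable def dirac (s : Ω) : Ω → ℝ := Pi.single s 1

/-- `μ(O) = ∑_{s ∈ O} μ(s)`. -/
noncomputable def prob (μ : Ω → ℝ) (O : Set Ω) : ℝ := ∑ s, O.indicator μ s

variable (Ω) in
/-- Atomic actions: maps sending each state to a closed convex set of distributions.
Values may be empty.  Thus this type contains the programs that terminate almost surely (all values
nonempty, see `Prog.IsProgram`), the tests (`b s ⊆ {dirac s}`), and it is closed under pointwise
intersection. -/
structure Prog where
  /-- the possible output distributions from a given state -/
  out : Ω → Set (Ω → ℝ)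
  out_subset : ∀ s, out s ⊆ stdSimplex ℝ Ω
  isClosed_out : ∀ s, IsClosed (out s)
  convex_out : ∀ s, Convex ℝ (out s)

namespace Prog

/-- `r` is a (nondeterministic) probabilistic program that terminates almost surely. -/
def IsProgram (r : Prog Ω) : Prop := ∀ s, (r.out s).Nonempty

/-- The refinement order: pointwise inclusion. -/
def Refines (r r' : Prog Ω) : Prop := ∀ s, r.out s ⊆ r'.out s

/-- The ineffectual program `δ` with `δ(s) = {dirac s}`. -/
noncomputable def skip : Prog Ω where
  out s := {dirac s}
  out_subset s := by
    classical
    rintro _ rfl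
    have h : dirac s = Pi.single s (1 : ℝ) := by unfold dirac; congr
    rw [h]
    exact single_mem_stdSimplex ℝ s
  isClosed_out _ := isClosed_singleton
  convex_out _ := convex_singleton _

/-- Pointwise intersection. -/
def inter (r r' : Prog Ω) : Prog Ω where
  out s := r.out s ∩ r'.out s
  out_subset s := fun _ h => r.out_subset s h.1
  isClosed_out s := (r.isClosed_out s).inter (r'.isClosed_out s)
  convex_out s := (r.convex_out s).inter (r'.convex_out s)

/-- The set of all probabilistic choices between an element of `A` and an element of `B`. -/
def choiceSet {Ω : Type*} (A B : Set (Ω → ℝ)) : Set (Ω → ℝ) :=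
  {ν | ∃ p ∈ Set.Icc (0 : ℝ) 1, ∃ μ ∈ A, ∃ μ' ∈ B, ν = (1 - p) • μ + p • μ'}

theorem choiceSet_eq_convexJoin {Ω : Type*} (A B : Set (Ω → ℝ)) : choiceSet A B = convexJoin ℝ A B := by
  ext ν
  simp only [mem_convexJoin, segment_eq_image, Set.mem_image]
  constructor
  · rintro ⟨p, hp, μ, hμ, μ', hμ', rfl⟩
    exact ⟨μ, hμ, μ', hμ', p, hp, rfl⟩
  · rintro ⟨μ, hμ, μ', hμ', p, hp, rfl⟩
    exact ⟨p, hp, μ, hμ, μ', hμ', rfl⟩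

theorem isCompact_out (r : Prog Ω) (s : Ω) : IsCompact (r.out s) :=
  (isCompact_stdSimplex ℝ Ω).of_isClosed_subset (r.isClosed_out s) (r.out_subset s)

/-- Nondeterministic choice of programs: `(r + r')(s)` consists of all the probabilistic choices
between an element of `r(s)` and an element of `r'(s)`. -/
def choice (r r' : Prog Ω) : Prog Ω where
  out s := choiceSet (r.out s) (r'.out s)
  out_subset s := by
    rintro _ ⟨p, hp, μ, hμ, μ', hμ', rfl⟩
    exact convex_stdSimplex ℝ Ω (r.out_subset s hμ) (r'.out_subset s hμ')
      (sub_nonneg.2 hp.2) hp.1 (by ring)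
  isClosed_out s := by
    have h : choiceSet (r.out s) (r'.out s) =
        (fun q : ℝ × (Ω → ℝ) × (Ω → ℝ) => (1 - q.1) • q.2.1 + q.1 • q.2.2) ''
          (Set.Icc 0 1 ×ˢ (r.out s ×ˢ r'.out s)) := by
      ext ν
      constructor
      · rintro ⟨p, hp, μ, hμ, μ', hμ', rfl⟩
        exact ⟨(p, μ, μ'), ⟨hp, hμ, hμ'⟩, rfl⟩
      · rintro ⟨⟨p, μ, μ'⟩, ⟨hp, hμ, hμ'⟩, rfl⟩
        exact ⟨p, hp, μ, hμ, μ', hμ', rfl⟩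
    rw [h]
    refine ((isCompact_Icc.prod ((r.isCompact_out s).prod (r'.isCompact_out s))).image
      ?_).isClosed
    fun_prop
  convex_out s := by
    rw [choiceSet_eq_convexJoin]
    exact (r.convex_out s).convexJoin (r'.convex_out s)

end Prog

end Programs

/-! ## Bundle event structures with internal probability -/

/-- A bundle event structure with internal probability, with `E` as its set of events:
a conflict relation, a bundle relation (`bundle x e` is `x ↦ e`), labels that are atomic
actions, and a family of sets of final events.  Bundles and final sets consist of pairwise
conflicting events. -/
structure EventStructure (Ω : Type*) [Fintype Ω] (E : Type*) where
  /-- the conflict relation `#` -/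
  conflict : E → E → Prop
  /-- the bundle relation `↦` -/
  bundle : Set E → E → Prop
  /-- the labelling `λ` -/
  label : E → Prog Ω
  /-- the family `Φ` of sets of final events -/
  final : Set (Set E)
  conflict_irrefl : ∀ e, ¬ conflict e e
  conflict_symm : ∀ e e', conflict e e' → conflict e' e
  bundle_conflict : ∀ x e, bundle x e → x.Pairwise conflict
  final_conflict : ∀ x ∈ final, x.Pairwise conflict

namespace EventStructure

section Basic

variable {Ω : Type*} [Fintype Ω] {E F : Type*}

/-! ### Traces -/

/-- The event `e` is enabled after the events in `α`: it has not occurred, it is not in conflict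
with an event that has occurred, and each bundle pointing to it has an event that has occurred. -/
def Enabled (A : EventStructure Ω E) (α : List E) (e : E) : Prop :=
  e ∉ α ∧ (∀ a ∈ α, ¬ A.conflict a e) ∧ ∀ x, A.bundle x e → ∃ a ∈ α, a ∈ x

/-- Finite traces: sequences of events each of which is enabled after the preceding ones. -/
inductive IsTrace (A : EventStructure Ω E) : List E → Prop
  | nil : A.IsTrace []
  | snoc (α : List E) (e : E) : A.IsTrace α → A.Enabled α e → A.IsTrace (α ++ [e])

/-- Maximal traces.  (Since prefixes of traces are traces, it is enough to look at one-event
extensions.) -/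
def IsMaxTrace (A : EventStructure Ω E) (α : List E) : Prop :=
  A.IsTrace α ∧ ∀ e, ¬ A.IsTrace (α ++ [e])

/-- Weakly maximal traces: maximal ones, and those that can be extended to a maximal trace by
events whose labels `λ(e)` satisfy `δ ⊑ λ(e)`. -/
def IsWeaklyMaxTrace (A : EventStructure Ω E) (α : List E) : Prop :=
  A.IsTrace α ∧ ∃ l : List E, A.IsMaxTrace (α ++ l) ∧ ∀ e ∈ l, Prog.skip.Refines (A.label e)

/-! ### Schedulers and sequential behaviour -/

/-- Schedulers.  `σ α e t` is the subdistribution `σ(α)(e, t)`; the partial map `σ(α)`, defined on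
the pairs `(e, t)` such that `α e` is a trace, is extended by `0`.  The map `w` is the weight
function at the trace `α`: `w e t` is the probability that `e` is scheduled when the current
state is `t`. -/
def IsScheduler (A : EventStructure Ω E) (σ : List E → E → Ω → Ω → ℝ) : Prop :=
  (∀ α e t, ¬ A.IsTrace (α ++ [e]) → σ α e t = 0) ∧
  ∀ α, A.IsTrace α → ∃ w : E → Ω → ℝ,
    (∀ e t, w e t ∈ Set.Icc (0 : ℝ) 1) ∧
    (∀ e t, A.IsTrace (α ++ [e]) → ((A.label e).out t).Nonempty →
      ∃ μ ∈ (A.label e).out t, σ α e t = w e t • μ) ∧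
    (∀ e t, A.IsTrace (α ++ [e]) → (A.label e).out t = ∅ → w e t = 0 ∧ σ α e t = 0) ∧
    (¬ A.IsMaxTrace α → ∀ t, HasSum (fun e : {e // A.IsTrace (α ++ [e])} => w e t) 1)

/-- The effect of performing the events of a list after the trace `β`, from the subdistribution
`μ` on states. -/
def runFrom (σ : List E → E → Ω → Ω → ℝ) : List E → (Ω → ℝ) → List E → Ω → ℝ
  | _, μ, [] => μ
  | β, μ, e :: l => runFrom σ (β ++ [e]) (fun u => ∑ t, σ β e t u * μ t) l

/-- The complete run `φ` from the initial state `s`. -/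
noncomputable def run (σ : List E → E → Ω → Ω → ℝ) (s : Ω) (α : List E) : Ω → ℝ :=
  runFrom σ [] (dirac s) α

theorem run_nil (σ : List E → E → Ω → Ω → ℝ) (s : Ω) : run σ s [] = dirac s := rfl

/-- The recursion `φ(α e)(u) = ∑ₜ σ(α)(e, t)(u) φ(α)(t)`. -/
theorem run_snoc (σ : List E → E → Ω → Ω → ℝ) (s : Ω) (α : List E) (e : E) :
    run σ s (α ++ [e]) = fun u => ∑ t, σ α e t u * run σ s α t := by
  have key : ∀ (l β : List E) (μ : Ω → ℝ), runFrom σ β μ (l ++ [e]) =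
      fun u => ∑ t, σ (β ++ l) e t u * runFrom σ β μ l t := by
    intro l
    induction l with
    | nil => intro β μ; simp [runFrom]
    | cons a l ih => intro β μ; simp [runFrom, ih]
  simpa [run] using key α [] (dirac s)

/-- The sequential behaviour `σ_s(A) = ∑_{α maximal} φ(α)`. -/
noncomputable def behaviour (A : EventStructure Ω E) (σ : List E → E → Ω → Ω → ℝ) (s : Ω) :
    Ω → ℝ :=
  fun u => ∑' α : {α // A.IsMaxTrace α}, run σ s α u

/-- The schedulers under which `A` terminates almost surely from every initial state. -/
def IsTerminatingScheduler (A : EventStructure Ω E) (σ : List E → E → Ω → Ω → ℝ) : Prop :=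
  A.IsScheduler σ ∧ ∀ s, A.behaviour σ s ∈ stdSimplex ℝ Ω

/-- The semantic bracket `⟦A⟧(s)`: the closed convex hull of the sequential behaviours of `A`
from `s`, over all terminating schedulers. -/
noncomputable def sem (A : EventStructure Ω E) (s : Ω) : Set (Ω → ℝ) :=
  closure (convexHull ℝ {μ | ∃ σ, A.IsTerminatingScheduler σ ∧ μ = A.behaviour σ s})

/-- `⟦A⟧(s)(O) ≥ p`. -/
def SemGe (A : EventStructure Ω E) (s : Ω) (O : Set Ω) (p : ℝ) : Prop :=
  ∀ μ ∈ A.sem s, p ≤ prob μ O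

/-! ### Simulation -/

/-- `f`, restricted to the traces of `A`, is a t-simulation from `A` to `B`. -/
structure IsTSimulation (A : EventStructure Ω E) (B : EventStructure Ω F)
    (f : List E → List F) : Prop where
  isTrace : ∀ α, A.IsTrace α → B.IsTrace (f α)
  map_nil : f [] = []
  finite_fiber : ∀ β, B.IsTrace β → {α | A.IsTrace α ∧ f α = β}.Finite
  step : ∀ α e, A.IsTrace (α ++ [e]) →
    (f (α ++ [e]) = f α ∧ (A.label e).Refines Prog.skip) ∨
    ∃ e', (A.label e).Refines (B.label e') ∧ f (α ++ [e]) = f α ++ [e']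
  maximal : ∀ α e, A.IsMaxTrace (α ++ [e]) →
    (∃ e', (A.label e).Refines (B.label e') ∧ f (α ++ [e]) = f α ++ [e']) ∧
    B.IsWeaklyMaxTrace (f (α ++ [e]))

/-- `A` is simulated by `B`. -/
def Sim (A : EventStructure Ω E) (B : EventStructure Ω F) : Prop :=
  ∃ f, IsTSimulation A B f

/-! ### Regular operations

The event sets of the operands are made disjoint by forming the sum type. -/

/-- The event structure with a single event, labelled by `r`. -/
def atom (r : Prog Ω) : EventStructure Ω Unit where
  conflict _ _ := False
  bundle _ _ := False
  label _ := r
  final := {Set.univ}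
  conflict_irrefl _ := id
  conflict_symm _ _ := id
  bundle_conflict _ _ := False.elim
  final_conflict _ _ := fun _ _ _ _ h => (h rfl).elim

/-- The constant `1`. -/
noncomputable def one : EventStructure Ω Unit := atom Prog.skip

/-- Initial events: those to which no bundle points. -/
def initial (A : EventStructure Ω E) : Set E := {e | ∀ x, ¬ A.bundle x e}

/-- The union of the bundle relations of two structures. -/
inductive SumBundle (A : EventStructure Ω E) (B : EventStructure Ω F) : Set (E ⊕ F) → E ⊕ F → Prop
  | inl (x : Set E) (e : E) : A.bundle x e → SumBundle A B (Sum.inl '' x) (Sum.inl e)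
  | inr (y : Set F) (e : F) : B.bundle y e → SumBundle A B (Sum.inr '' y) (Sum.inr e)

/-- Conflicts inside either structure. -/
def parConflict (A : EventStructure Ω E) (B : EventStructure Ω F) : E ⊕ F → E ⊕ F → Prop
  | .inl e, .inl e' => A.conflict e e'
  | .inr e, .inr e' => B.conflict e e'
  | _, _ => False

theorem pairwise_inl {A : EventStructure Ω E} {x : Set E} (hx : x.Pairwise A.conflict)
    {R : E ⊕ F → E ⊕ F → Prop} (hR : ∀ a b, A.conflict a b → R (.inl a) (.inl b)) :
    (Sum.inl '' x : Set (E ⊕ F)).Pairwise R := by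
  rintro _ ⟨a, ha, rfl⟩ _ ⟨b, hb, rfl⟩ hab
  exact hR _ _ (hx ha hb fun h => hab (congrArg _ h))

theorem pairwise_inr {B : EventStructure Ω F} {x : Set F} (hx : x.Pairwise B.conflict)
    {R : E ⊕ F → E ⊕ F → Prop} (hR : ∀ a b, B.conflict a b → R (.inr a) (.inr b)) :
    (Sum.inr '' x : Set (E ⊕ F)).Pairwise R := by
  rintro _ ⟨a, ha, rfl⟩ _ ⟨b, hb, rfl⟩ hab
  exact hR _ _ (hx ha hb fun h => hab (congrArg _ h))

theorem SumBundle.pairwise {A : EventStructure Ω E} {B : EventStructure Ω F}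
    {x : Set (E ⊕ F)} {e : E ⊕ F} (h : SumBundle A B x e)
    {R : E ⊕ F → E ⊕ F → Prop} (hA : ∀ a b, A.conflict a b → R (.inl a) (.inl b))
    (hB : ∀ a b, B.conflict a b → R (.inr a) (.inr b)) : x.Pairwise R := by
  cases h with
  | inl x e h => exact pairwise_inl (A.bundle_conflict x e h) hA
  | inr y e h => exact pairwise_inr (B.bundle_conflict y e h) hB

/-- Concurrent composition `A ‖ B`. -/
def par (A : EventStructure Ω E) (B : EventStructure Ω F) : EventStructure Ω (E ⊕ F) where
  conflict := parConflict A B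
  bundle := SumBundle A B
  label := Sum.elim A.label B.label
  final := (fun x => Sum.inl '' x) '' A.final ∪ (fun y => Sum.inr '' y) '' B.final
  conflict_irrefl := by
    rintro (e | e)
    · exact A.conflict_irrefl e
    · exact B.conflict_irrefl e
  conflict_symm := by
    rintro (e | e) (e' | e') h
    · exact A.conflict_symm _ _ h
    · exact h.elim
    · exact h.elim
    · exact B.conflict_symm _ _ h
  bundle_conflict _ _ h := h.pairwise (fun _ _ => id) (fun _ _ => id)
  final_conflict := by
    rintro _ (⟨x, hx, rfl⟩ | ⟨y, hy, rfl⟩)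
    · exact pairwise_inl (A.final_conflict x hx) fun _ _ => id
    · exact pairwise_inr (B.final_conflict y hy) fun _ _ => id

/-- Sequential composition `A · B`: each final set of `A` becomes a bundle pointing to each initial
event of `B`. -/
def seq (A : EventStructure Ω E) (B : EventStructure Ω F) : EventStructure Ω (E ⊕ F) where
  conflict := parConflict A B
  bundle z a := SumBundle A B z a ∨
    ∃ x ∈ A.final, ∃ e ∈ B.initial, z = Sum.inl '' x ∧ a = Sum.inr e
  label := Sum.elim A.label B.label
  final := (fun y => Sum.inr '' y) '' B.final
  conflict_irrefl := (par A B).conflict_irrefl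
  conflict_symm := (par A B).conflict_symm
  bundle_conflict := by
    rintro z a (h | ⟨x, hx, e, -, rfl, rfl⟩)
    · exact (par A B).bundle_conflict z a h
    · exact pairwise_inl (A.final_conflict x hx) fun _ _ => id
  final_conflict := by
    rintro _ ⟨y, hy, rfl⟩
    exact pairwise_inr (B.final_conflict y hy) fun _ _ => id

/-- Conflict between an event of `A` and an event of `B` in `A + B`: both are final (in some final
set), or both are initial. -/
def CrossConflict (A : EventStructure Ω E) (B : EventStructure Ω F) (e : E) (e' : F) : Prop :=
  (∃ x ∈ A.final, ∃ y ∈ B.final, e ∈ x ∧ e' ∈ y) ∨ (e ∈ A.initial ∧ e' ∈ B.initial)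

/-- The conflict relation of `A + B`. -/
def addConflict (A : EventStructure Ω E) (B : EventStructure Ω F) : E ⊕ F → E ⊕ F → Prop
  | .inl e, .inl e' => A.conflict e e'
  | .inr e, .inr e' => B.conflict e e'
  | .inl e, .inr e' => CrossConflict A B e e'
  | .inr e', .inl e => CrossConflict A B e e'

/-- Nondeterministic choice `A + B`. -/
def add (A : EventStructure Ω E) (B : EventStructure Ω F) : EventStructure Ω (E ⊕ F) where
  conflict := addConflict A B
  bundle := SumBundle A B
  label := Sum.elim A.label B.label
  final := {z | ∃ x ∈ A.final, ∃ y ∈ B.final, z = Sum.inl '' x ∪ Sum.inr '' y}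
  conflict_irrefl := by
    rintro (e | e)
    · exact A.conflict_irrefl e
    · exact B.conflict_irrefl e
  conflict_symm := by
    rintro (e | e) (e' | e') h
    · exact A.conflict_symm _ _ h
    · exact h
    · exact h
    · exact B.conflict_symm _ _ h
  bundle_conflict _ _ h := h.pairwise (fun _ _ => id) (fun _ _ => id)
  final_conflict := by
    rintro _ ⟨x, hx, y, hy, rfl⟩ _ (⟨a, ha, rfl⟩ | ⟨a, ha, rfl⟩) _ (⟨b, hb, rfl⟩ | ⟨b, hb, rfl⟩) hab
    · exact A.final_conflict x hx ha hb fun h => hab (congrArg _ h)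
    · exact Or.inl ⟨x, hx, y, hy, ha, hb⟩
    · exact Or.inl ⟨x, hx, y, hy, hb, ha⟩
    · exact B.final_conflict y hy ha hb fun h => hab (congrArg _ h)

end Basic

/-! ### The binary Kleene star

`A * B` is the supremum of the increasing sequence `B`, `B + A · B`, `B + A · (B + A · B)`, …  The
events of the `n`-th approximant are identified with elements of `ℕ × (E ⊕ F)`: `(k, inl e)` is the
occurrence of `e` in the `k`-th copy of `A`, and `(k, inr e)` that in the `k`-th copy of `B`. -/

section Star

universe u

variable {Ω : Type*} [Fintype Ω] {E F : Type u}

/-- The events of the `n`-th approximant of `A * B`. -/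
@[reducible] def StarEvent (E F : Type u) : ℕ → Type u
  | 0 => F
  | n + 1 => F ⊕ (E ⊕ StarEvent E F n)

/-- The approximants `B`, `B + A · B`, `B + A · (B + A · B)`, … of `A * B`. -/
def starApprox (A : EventStructure Ω E) (B : EventStructure Ω F) :
    (n : ℕ) → EventStructure Ω (StarEvent E F n)
  | 0 => B
  | n + 1 => add B (seq A (starApprox A B n))

/-- The identification of the events of the `n`-th approximant with elements of `ℕ × (E ⊕ F)`. -/
def starEmb : (n : ℕ) → StarEvent E F n → ℕ × (E ⊕ F)
  | 0 => fun e => (0, Sum.inr e)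
  | n + 1 => Sum.elim (fun e => (0, Sum.inr e))
      (Sum.elim (fun e => (0, Sum.inl e)) fun x => ((starEmb n x).1 + 1, (starEmb n x).2))

theorem starEmb_injective : ∀ n, Function.Injective (starEmb (E := E) (F := F) n)
  | 0 => fun a b h => Sum.inr_injective (Prod.ext_iff.1 h).2
  | n + 1 => by
    have key : ∀ a b : F ⊕ (E ⊕ StarEvent E F n),
        starEmb (n + 1) a = starEmb (n + 1) b → a = b := by
      rintro (a | a | a) (b | b | b) h <;> obtain ⟨h₁, h₂⟩ := Prod.ext_iff.1 h <;>
        dsimp only [starEmb, Sum.elim_inl, Sum.elim_inr] at h₁ h₂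
      · rw [Sum.inr_injective h₂]
      · cases h₂
      · omega
      · cases h₂
      · rw [Sum.inl_injective h₂]
      · omega
      · omega
      · omega
      · rw [starEmb_injective n (Prod.ext (Nat.succ_injective h₁) h₂)]
    exact key

theorem exists_starEmb_eq : ∀ (n : ℕ) (a : ℕ × (E ⊕ F)), a.1 < n → ∃ x, starEmb n x = a
  | 0, _, h => absurd h (Nat.not_lt_zero _)
  | n + 1, (0, .inl e), _ => ⟨(.inr (.inl e) : F ⊕ (E ⊕ StarEvent E F n)), rfl⟩
  | n + 1, (0, .inr e), _ => ⟨(.inl e : F ⊕ (E ⊕ StarEvent E F n)), rfl⟩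
  | n + 1, (k + 1, b), h => by
    obtain ⟨x, hx⟩ := exists_starEmb_eq n (k, b) (Nat.lt_of_succ_lt_succ h)
    refine ⟨(.inr (.inr x) : F ⊕ (E ⊕ StarEvent E F n)), ?_⟩
    change ((starEmb n x).1 + 1, (starEmb n x).2) = _
    rw [hx]

/-- The binary Kleene star `A * B`.  Conflicts and bundles are those of the approximants; the final
sets are the sets of events whose trace on each approximant is a final set of it. -/
def star (A : EventStructure Ω E) (B : EventStructure Ω F) : EventStructure Ω (ℕ × (E ⊕ F)) where
  conflict a b := ∃ n x y, (starApprox A B n).conflict x y ∧ starEmb n x = a ∧ starEmb n y = b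
  bundle z a := ∃ n x e, (starApprox A B n).bundle x e ∧ starEmb n '' x = z ∧ starEmb n e = a
  label a := Sum.elim A.label B.label a.2
  final := {z | ∀ n, starEmb n ⁻¹' z ∈ (starApprox A B n).final}
  conflict_irrefl := by
    rintro a ⟨n, x, y, h, rfl, hy⟩
    rw [starEmb_injective n hy] at h
    exact (starApprox A B n).conflict_irrefl x h
  conflict_symm := by
    rintro a b ⟨n, x, y, h, hx, hy⟩
    exact ⟨n, y, x, (starApprox A B n).conflict_symm x y h, hy, hx⟩
  bundle_conflict := by
    rintro _ _ ⟨n, x, e, h, rfl, -⟩ _ ⟨a, ha, rfl⟩ _ ⟨b, hb, rfl⟩ hab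
    exact ⟨n, a, b, (starApprox A B n).bundle_conflict x e h ha hb fun h => hab (congrArg _ h),
      rfl, rfl⟩
  final_conflict := by
    intro z hz a ha b hb hab
    obtain ⟨x, hx⟩ := exists_starEmb_eq (max a.1 b.1 + 1) a (by omega)
    obtain ⟨y, hy⟩ := exists_starEmb_eq (max a.1 b.1 + 1) b (by omega)
    refine ⟨max a.1 b.1 + 1, x, y, (starApprox A B _).final_conflict _ (hz _) ?_ ?_ ?_, hx, hy⟩
    · simpa [hx] using ha
    · simpa [hy] using hb
    · rintro rfl
      exact hab (hx.symm.trans hy)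

end Star

end EventStructure

/-- `r^* = r * 1`, for an atomic program `r`. -/
noncomputable def Prog.iter {Ω : Type*} [Fintype Ω] (r : Prog Ω) :
    EventStructure Ω (ℕ × (Unit ⊕ Unit)) :=
  EventStructure.star (EventStructure.atom r) EventStructure.one

end RelyGuarantee

namespace RelyGuarantee

/-! ### Explicit description of `r^*`

Writing `rₖ` for `(k, inl ())` and `δₖ` for `(k, inr ())`, the conflicts of `r^*` are `rₖ # δₖ` and
`δₖ # δₗ` for `k ≠ l`, and its bundles are `{rₖ} ↦ rₖ₊₁` and `{rₖ} ↦ δₖ₊₁`. -/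

namespace Prog

open EventStructure

variable {Ω : Type*} [Fintype Ω] (r : Prog Ω)

/-- The conflicts of `r^*`. -/
def IterConflict : ℕ × (Unit ⊕ Unit) → ℕ × (Unit ⊕ Unit) → Prop
  | (i, .inl _), (j, .inr _) => i = j
  | (i, .inr _), (j, .inl _) => i = j
  | (i, .inr _), (j, .inr _) => i ≠ j
  | (_, .inl _), (_, .inl _) => False

theorem initial_one : (one : EventStructure Ω Unit).initial = Set.univ :=
  Set.eq_univ_of_forall fun _ _ h => h

theorem initial_seq_atom {F : Type*} (B : EventStructure Ω F) :
    (seq (atom r) B).initial = {.inl ()} := by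
  ext (x | x)
  · refine ⟨fun _ => rfl, fun _ z h => ?_⟩
    rcases h with h | ⟨_, _, _, _, _, h⟩
    · cases h; assumption
    · cases h
  · refine ⟨fun h => ?_, fun h => by cases h⟩
    exfalso
    by_cases hx : x ∈ B.initial
    · exact h _ (Or.inr ⟨_, rfl, x, hx, rfl, rfl⟩)
    · obtain ⟨z, hz⟩ : ∃ z, B.bundle z x := by
        by_contra hh
        exact hx fun z hz => hh ⟨z, hz⟩
      exact h _ (Or.inl (.inr _ _ hz))

theorem final_starApprox : ∀ n, (starApprox (atom r) one n).final =
    {{x | (starEmb n x).2 = .inr ()}}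
  | 0 => by
    have h : (Set.univ : Set Unit) = {x : Unit | (starEmb (E := Unit) (F := Unit) 0 x).2 = .inr ()} :=
      (Set.eq_univ_of_forall fun _ => rfl).symm
    exact congrArg (fun z : Set Unit => ({z} : Set (Set Unit))) h
  | n + 1 => by
    have hz : ((Sum.inl '' Set.univ ∪ Sum.inr '' (Sum.inr '' {x | (starEmb n x).2 = .inr ()})) :
        Set (Unit ⊕ (Unit ⊕ StarEvent Unit Unit n))) =
        {x | (starEmb (n + 1) x).2 = .inr ()} := by
      apply Set.ext
      rintro (x | x | x)
      · exact ⟨fun _ => rfl, fun _ => Or.inl ⟨x, trivial, rfl⟩⟩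
      · refine ⟨?_, fun h => ?_⟩
        · rintro (⟨_, _, h⟩ | ⟨_, ⟨_, _, rfl⟩, h⟩) <;> cases h
        · cases h
      · refine ⟨?_, fun h => Or.inr ⟨.inr x, ⟨x, h, rfl⟩, rfl⟩⟩
        rintro (⟨_, _, h⟩ | ⟨_, ⟨_, h', rfl⟩, h⟩)
        · cases h
        · cases h
          exact h'
    have hf : (seq (atom r) (starApprox (atom r) one n)).final =
        {Sum.inr '' {x | (starEmb n x).2 = .inr ()}} := by
      change (fun y => Sum.inr '' y) '' (starApprox (atom r) one n).final = _
      rw [final_starApprox n, Set.image_singleton]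
    change {z | ∃ x ∈ (one : EventStructure Ω Unit).final,
      ∃ y ∈ (seq (atom r) (starApprox (atom r) one n)).final,
        z = Sum.inl '' x ∪ Sum.inr '' y} = _
    rw [hf, ← hz]
    ext z
    constructor
    · rintro ⟨_, rfl, _, rfl, rfl⟩
      rfl
    · rintro rfl
      exact ⟨_, rfl, _, rfl, rfl⟩

theorem crossConflict_starApprox (n : ℕ) (e : Unit) (e' : Unit ⊕ StarEvent Unit Unit n) :
    CrossConflict (one : EventStructure Ω Unit) (seq (atom r) (starApprox (atom r) one n)) e e' ↔
      e' = .inl () ∨ ∃ x, e' = .inr x ∧ (starEmb n x).2 = .inr () := by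
  have hf : (seq (atom r) (starApprox (atom r) one n)).final =
      {Sum.inr '' {x | (starEmb n x).2 = .inr ()}} := by
    change (fun y => Sum.inr '' y) '' (starApprox (atom r) one n).final = _
    rw [final_starApprox, Set.image_singleton]
  unfold CrossConflict
  rw [initial_seq_atom, initial_one, hf]
  constructor
  · rintro (⟨x, _, y, rfl, _, ⟨z, hz, rfl⟩⟩ | ⟨_, h⟩)
    · exact Or.inr ⟨z, rfl, hz⟩
    · exact Or.inl h
  · rintro (h | ⟨z, rfl, hz⟩)
    · exact Or.inr ⟨trivial, h⟩
    · exact Or.inl ⟨_, rfl, _, rfl, trivial, ⟨z, hz, rfl⟩⟩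

theorem conflict_starApprox : ∀ n x y, (starApprox (atom r) one n).conflict x y ↔
    IterConflict (starEmb n x) (starEmb n y)
  | 0, _, _ => ⟨fun h => h.elim, fun h => h rfl⟩
  | n + 1, x, y => by
    have hc := crossConflict_starApprox r n
    have hs : ∀ y : StarEvent Unit Unit n,
        CrossConflict (one : EventStructure Ω Unit) (seq (atom r) (starApprox (atom r) one n)) ()
          (.inr y) ↔ (starEmb n y).2 = .inr () := by
      intro y
      rw [hc]
      constructor
      · rintro (h | ⟨x, h, hx⟩)
        · cases h
        · cases h
          exact hx
      · exact fun h => Or.inr ⟨y, rfl, h⟩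
    have key : ∀ x y : Unit ⊕ (Unit ⊕ StarEvent Unit Unit n),
        addConflict (one : EventStructure Ω Unit) (seq (atom r) (starApprox (atom r) one n)) x y ↔
          IterConflict (starEmb (n + 1) x) (starEmb (n + 1) y) := by
      rintro (x | x | x) (y | y | y)
      · exact ⟨fun h => h.elim, fun h => h rfl⟩
      · exact ⟨fun _ => rfl, fun _ => (hc _ _).2 (Or.inl rfl)⟩
      · refine (hs y).trans ?_
        change _ ↔ IterConflict (0, .inr ()) ((starEmb n y).1 + 1, (starEmb n y).2)
        rcases starEmb n y with ⟨k, (_ | _)⟩ <;> simp [IterConflict]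
      · exact ⟨fun _ => rfl, fun _ => (hc _ _).2 (Or.inl rfl)⟩
      · exact ⟨fun h => h.elim, fun h => h.elim⟩
      · change False ↔ IterConflict (0, .inl ()) ((starEmb n y).1 + 1, (starEmb n y).2)
        rcases starEmb n y with ⟨k, (_ | _)⟩ <;> simp [IterConflict]
      · refine (hs x).trans ?_
        change _ ↔ IterConflict ((starEmb n x).1 + 1, (starEmb n x).2) (0, .inr ())
        rcases starEmb n x with ⟨k, (_ | _)⟩ <;> simp [IterConflict]
      · change False ↔ IterConflict ((starEmb n x).1 + 1, (starEmb n x).2) (0, .inl ())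
        rcases starEmb n x with ⟨k, (_ | _)⟩ <;> simp [IterConflict]
      · change (starApprox (atom r) one n).conflict x y ↔
          IterConflict ((starEmb n x).1 + 1, (starEmb n x).2)
            ((starEmb n y).1 + 1, (starEmb n y).2)
        rw [conflict_starApprox n x y]
        rcases starEmb n x with ⟨k, (_ | _)⟩ <;> rcases starEmb n y with ⟨l, (_ | _)⟩ <;>
          simp [IterConflict]
    exact key x y

theorem iter_conflict_iff (a b : ℕ × (Unit ⊕ Unit)) :
    r.iter.conflict a b ↔ IterConflict a b := by
  constructor
  · rintro ⟨n, x, y, h, rfl, rfl⟩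
    exact (conflict_starApprox r n x y).1 h
  · intro h
    obtain ⟨x, hx⟩ := exists_starEmb_eq (max a.1 b.1 + 1) a (by omega)
    obtain ⟨y, hy⟩ := exists_starEmb_eq (max a.1 b.1 + 1) b (by omega)
    refine ⟨_, x, y, (conflict_starApprox r _ x y).2 ?_, hx, hy⟩
    rwa [hx, hy]

theorem starEmb_fst_le {E F : Type} : ∀ n (e : StarEvent E F n), (starEmb n e).1 ≤ n
  | 0, _ => le_rfl
  | _ + 1, .inl _ => Nat.zero_le _
  | _ + 1, .inr (.inl _) => Nat.zero_le _
  | n + 1, .inr (.inr e) => Nat.succ_le_succ (starEmb_fst_le n e)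

theorem bundle_starApprox : ∀ n x e, (starApprox (atom r) one n).bundle x e ↔
    ∃ k, (starEmb n e).1 = k + 1 ∧ starEmb n '' x = {(k, .inl ())}
  | 0, x, e => ⟨fun h => h.elim, fun ⟨k, h, _⟩ => absurd h (Nat.succ_ne_zero k).symm⟩
  | n + 1, x, e => by
    have hi : ∀ e, e ∈ (starApprox (atom r) one n).initial ↔ (starEmb n e).1 = 0 := by
      intro e
      constructor
      · intro h
        by_contra h0
        obtain ⟨k, hk⟩ := Nat.exists_eq_succ_of_ne_zero h0
        have hn := starEmb_fst_le n e
        obtain ⟨y, hy⟩ := exists_starEmb_eq (E := Unit) (F := Unit) n (k, .inl ()) (by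
          simp only; omega)
        exact h {y} ((bundle_starApprox n _ _).2 ⟨k, hk, by rw [Set.image_singleton, hy]⟩)
      · intro h z hz
        obtain ⟨k, hk, -⟩ := (bundle_starApprox n _ _).1 hz
        omega
    have key : ∀ (x : Set (Unit ⊕ (Unit ⊕ StarEvent Unit Unit n)))
        (e : Unit ⊕ (Unit ⊕ StarEvent Unit Unit n)),
        SumBundle (one : EventStructure Ω Unit) (seq (atom r) (starApprox (atom r) one n)) x e ↔
          ∃ k, (starEmb (n + 1) e).1 = k + 1 ∧ starEmb (n + 1) '' x = {(k, .inl ())} := by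
      intro x e
      constructor
      · rintro (⟨_, _, h⟩ | ⟨y, e, h⟩)
        · exact h.elim
        · rcases h with (⟨_, _, h⟩ | ⟨z, e, h⟩) | ⟨_, rfl, e, he, rfl, rfl⟩
          · exact h.elim
          · obtain ⟨k, hk, hz⟩ := (bundle_starApprox n z e).1 h
            refine ⟨k + 1, congrArg Nat.succ hk, ?_⟩
            rw [Set.image_image, Set.image_image]
            change (fun x => ((starEmb n x).1 + 1, (starEmb n x).2)) '' z = _
            rw [← Set.image_image (fun a : ℕ × (Unit ⊕ Unit) => (a.1 + 1, a.2)), hz,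
              Set.image_singleton]
          · refine ⟨0, congrArg Nat.succ ((hi e).1 he), ?_⟩
            rw [Set.image_image, Set.image_image]
            change (fun _ => ((0, .inl ()) : ℕ × (Unit ⊕ Unit))) '' Set.univ = _
            exact Set.Nonempty.image_const ⟨(), Set.mem_univ _⟩ _
      · rintro ⟨k, hk, hx⟩
        obtain ⟨x₀, rfl, hx₀⟩ : ∃ x₀, x = {x₀} ∧ starEmb (n + 1) x₀ = (k, .inl ()) := by
          obtain ⟨x₀, h₀, h₁⟩ : (k, .inl ()) ∈ starEmb (n + 1) '' x := by rw [hx]; rfl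
          refine ⟨x₀, Set.eq_singleton_iff_unique_mem.2 ⟨h₀, fun y hy => ?_⟩, h₁⟩
          have : starEmb (n + 1) y ∈ starEmb (n + 1) '' x := ⟨y, hy, rfl⟩
          rw [hx] at this
          exact starEmb_injective (n + 1) (Eq.trans this h₁.symm)
        rcases e with e | e | e
        · exact absurd hk (Nat.succ_ne_zero k).symm
        · exact absurd hk (Nat.succ_ne_zero k).symm
        · have hk' : (starEmb n e).1 = k := Nat.succ_injective hk
          rcases x₀ with x₀ | x₀ | x₀
          · cases (Prod.ext_iff.1 hx₀).2
          · have h0 : 0 = k := (Prod.ext_iff.1 hx₀).1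
            have h := SumBundle.inr (A := (one : EventStructure Ω Unit))
              (B := seq (atom r) (starApprox (atom r) one n)) _ _
              (Or.inr ⟨Set.univ, rfl, e, (hi e).2 (hk'.trans h0.symm), rfl, rfl⟩)
            convert h using 1
            have hu : (Set.univ : Set Unit) = {x₀} := Set.eq_singleton_iff_unique_mem.2
              ⟨trivial, fun _ _ => rfl⟩
            rw [hu, Set.image_singleton, Set.image_singleton]
          · have h1 : (starEmb n x₀).1 + 1 = k := (Prod.ext_iff.1 hx₀).1
            have h2 : (starEmb n x₀).2 = .inl () := (Prod.ext_iff.1 hx₀).2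
            have h := SumBundle.inr (A := (one : EventStructure Ω Unit))
              (B := seq (atom r) (starApprox (atom r) one n)) _ _
              (Or.inl (.inr _ _ ((bundle_starApprox n {x₀} e).2
                ⟨(starEmb n x₀).1, hk'.trans h1.symm, by
                  rw [Set.image_singleton, ← h2]⟩)))
            rwa [Set.image_singleton, Set.image_singleton] at h
    exact key x e

theorem iter_bundle_iff (x : Set (ℕ × (Unit ⊕ Unit))) (a : ℕ × (Unit ⊕ Unit)) :
    r.iter.bundle x a ↔ ∃ k, a.1 = k + 1 ∧ x = {(k, .inl ())} := by
  constructor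
  · rintro ⟨n, y, e, h, rfl, rfl⟩
    exact (bundle_starApprox r n y e).1 h
  · rintro ⟨k, hk, rfl⟩
    obtain ⟨e, he⟩ := exists_starEmb_eq (a.1 + 1) a (by omega)
    obtain ⟨y, hy⟩ := exists_starEmb_eq (E := Unit) (F := Unit) (a.1 + 1) (k, .inl ()) (by
      simp only; omega)
    refine ⟨_, {y}, e, (bundle_starApprox r _ _ _).2 ⟨k, ?_, ?_⟩, ?_, he⟩
    · rwa [he]
    all_goals rw [Set.image_singleton, hy]

end Prog

end RelyGuarantee

/-! Only the two separate bounds need work: the closed convex hull in `sem` does not affect lower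
bounds of probabilities (`semGe_of_forall`), and for one distribution `μ(O₁) + μ(O₂) - 1 ≤ μ(O₁ ∩
O₂)` (`prob_inter_ge`).

For the first bound, let `σ` be a terminating scheduler of the whole composition. Seen from `E₁`,
the rest can be imitated by `r₁^*`. A copy of `r₁ ∩ r₂` is a special case of `r₁`. Each event of
`E₂` is either ineffectual, and is dropped, or refines `g'`, hence `r₁` (`Sim.refines_of_iter`), and
becomes a copy of `r₁`. The closing `δ` of the star is dropped and performed only after everything
else. This maps traces to traces of `r₁^* ‖ E₁` (`isReduction_mirror`). The second bound follows by
exchanging `E₁` and `E₂`.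

Such a map transports schedulers (`IsReduction.exists_isScheduler`). The probability mass of `σ` is
pushed forward as a flow on the tree of traces, and the new scheduler is the conditional probability
of the next step. Fibres are finite, so no mass is lost by dropping events forever, and dropped
events leave the state unchanged. Convexity keeps the averaged outputs inside the labels.

Conditional probabilities depend on the initial weights, so one scheduler need not reproduce the
behaviour from every initial state, yet `SemGe` concerns schedulers terminating from all of them.
The remedy is a start with weights `ν` positive everywhere and concentrated near `s₀`. Equality of
the `ν`-averaged masses forces termination from each state, and the perturbation then tends to zero
(`IsReduction.le_prob_behaviour`). At histories of mass zero the new scheduler still has to move;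
`exists_isTrace_snoc_of_isTerminatingScheduler` extracts a possible move from the existence of `σ`.

The simulation claim only needs the numbers of effectual events in the two components, which are
added up (`IsCounting`, `par_sim_iter`). -/

namespace RelyGuarantee

/-! ### Scaled members of a set of distributions -/

section Scaled

variable {Ω : Type*} {C D : Set (Ω → ℝ)} {c d : ℝ} {v w : Ω → ℝ}

/-- `v` is `c` times a member of `C`, where the zero vector is regarded as `0` times a member of `C`
even if `C` is empty. -/
def IsScaled (C : Set (Ω → ℝ)) (c : ℝ) (v : Ω → ℝ) : Prop :=
  0 ≤ c ∧ ((∃ μ ∈ C, v = c • μ) ∨ (c = 0 ∧ v = 0))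

theorem IsScaled.zero : IsScaled C 0 0 := ⟨le_rfl, Or.inr ⟨rfl, rfl⟩⟩

theorem IsScaled.of_mem (h : v ∈ C) : IsScaled C 1 v := ⟨zero_le_one, Or.inl ⟨v, h, by simp⟩⟩

theorem IsScaled.mono (hCD : C ⊆ D) (h : IsScaled C c v) : IsScaled D c v := by
  obtain ⟨hc, ⟨μ, hμ, rfl⟩ | h⟩ := h
  · exact ⟨hc, Or.inl ⟨μ, hCD hμ, rfl⟩⟩
  · exact ⟨hc, Or.inr h⟩

theorem IsScaled.smul {a : ℝ} (ha : 0 ≤ a) (h : IsScaled C c v) : IsScaled C (a * c) (a • v) := by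
  obtain ⟨hc, ⟨μ, hμ, rfl⟩ | ⟨rfl, rfl⟩⟩ := h
  · exact ⟨mul_nonneg ha hc, Or.inl ⟨μ, hμ, smul_smul _ _ _⟩⟩
  · simpa using IsScaled.zero

theorem IsScaled.eq_zero (h : IsScaled C 0 v) : v = 0 := by
  obtain ⟨-, ⟨μ, -, rfl⟩ | ⟨-, rfl⟩⟩ := h
  · simp
  · rfl

/-- After normalisation by `c + d` this is convexity. Zero coefficients are treated apart, since
they carry no member of `C`, which may be empty. -/
theorem IsScaled.add (hC : Convex ℝ C) (h : IsScaled C c v) (h' : IsScaled C d w) :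
    IsScaled C (c + d) (v + w) := by
  rcases eq_or_ne c 0 with rfl | hc
  · rw [h.eq_zero]; simpa using h'
  rcases eq_or_ne d 0 with rfl | hd
  · rw [h'.eq_zero]; simpa using h
  obtain ⟨hc0, ⟨μ, hμ, rfl⟩ | h⟩ := h
  · obtain ⟨hd0, ⟨μ', hμ', rfl⟩ | h'⟩ := h'
    · have hpos : 0 < c + d := add_pos (lt_of_le_of_ne hc0 hc.symm) (lt_of_le_of_ne hd0 hd.symm)
      refine ⟨hpos.le, Or.inl ⟨(c / (c + d)) • μ + (d / (c + d)) • μ',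
        hC hμ hμ' (by positivity) (by positivity) (by field_simp), ?_⟩⟩
      rw [smul_add, smul_smul, smul_smul, mul_div_cancel₀ _ hpos.ne', mul_div_cancel₀ _ hpos.ne']
    · exact absurd h'.1 hd
  · exact absurd h.1 hc

theorem IsScaled.sum (hC : Convex ℝ C) {ι : Type*} (s : Finset ι) {c : ι → ℝ} {v : ι → Ω → ℝ}
    (h : ∀ i ∈ s, IsScaled C (c i) (v i)) : IsScaled C (∑ i ∈ s, c i) (∑ i ∈ s, v i) := by
  classical
  induction s using Finset.induction_on with
  | empty => simpa using IsScaled.zero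
  | insert a s ha ih =>
    rw [Finset.sum_insert ha, Finset.sum_insert ha]
    exact (h a (by simp)).add hC (ih fun i hi => h i (by simp [hi]))

theorem IsScaled.apply_nonneg [Fintype Ω] (hC : C ⊆ stdSimplex ℝ Ω) (h : IsScaled C c v) (u : Ω) :
    0 ≤ v u := by
  obtain ⟨hc, ⟨μ, hμ, rfl⟩ | ⟨rfl, rfl⟩⟩ := h
  · exact mul_nonneg hc ((hC hμ).1 u)
  · simp

theorem IsScaled.sum_apply [Fintype Ω] (hC : C ⊆ stdSimplex ℝ Ω) (h : IsScaled C c v) :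
    ∑ u, v u = c := by
  obtain ⟨hc, ⟨μ, hμ, rfl⟩ | ⟨rfl, rfl⟩⟩ := h
  · simp [← Finset.mul_sum, (hC hμ).2]
  · simp

theorem IsScaled.eq_smul_dirac [Fintype Ω] {t : Ω} (h : IsScaled {dirac t} c v) :
    v = c • dirac t := by
  obtain ⟨hc, ⟨μ, rfl, rfl⟩ | ⟨rfl, rfl⟩⟩ := h
  · rfl
  · simp

end Scaled

/-! ### Sums over finite sequences -/

/-- A nonempty list is given by its first element and the remaining list. -/
def listEquivSum (E : Type*) : List E ≃ Unit ⊕ (E × List E) where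
  toFun
    | [] => .inl ()
    | e :: l => .inr (e, l)
  invFun
    | .inl _ => []
    | .inr (e, l) => e :: l
  left_inv l := by cases l <;> rfl
  right_inv o := by rcases o with _ | ⟨e, l⟩ <;> rfl

theorem tsum_list_cons {E : Type*} (f : List E → ENNReal) :
    ∑' l, f l = f [] + ∑' e, ∑' l, f (e :: l) := by
  rw [← (listEquivSum E).symm.tsum_eq, ENNReal.summable.tsum_sum ENNReal.summable,
    ENNReal.tsum_prod']
  simp [listEquivSum]

/-- If the mass at each node of a tree is at least the mass stopped there plus the mass of the
successors, then the stopped mass is at most the mass at the root. -/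
theorem tsum_list_le_of_step {E : Type*} (M S : List E → ENNReal)
    (h : ∀ γ, S γ + ∑' e, M (γ ++ [e]) ≤ M γ) : ∑' γ, S γ ≤ M [] := by
  -- Truncation at depth `n` makes an induction possible; an arbitrary finite set of nodes lies
  -- below some depth.
  have key : ∀ (n : ℕ) (γ : List E),
      ∑' l : List E, (if l.length < n then S (γ ++ l) else 0) ≤ M γ := by
    intro n
    induction n with
    | zero => intro γ; simp
    | succ n ih =>
      intro γ
      rw [tsum_list_cons]
      refine le_trans ?_ (h γ)
      simp only [List.length_nil, Nat.zero_lt_succ, if_true, List.append_nil, List.length_cons,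
        Nat.succ_lt_succ_iff]
      gcongr with e
      simpa using ih (γ ++ [e])
  rw [ENNReal.tsum_eq_iSup_sum]
  refine iSup_le fun s => ?_
  refine le_trans ?_ (key (s.sup List.length + 1) [])
  refine le_trans (Finset.sum_le_sum fun l hl => ?_) (ENNReal.sum_le_tsum s)
  rw [if_pos (Nat.lt_succ_of_le (Finset.le_sup hl))]
  rfl

namespace EventStructure

/-! ### Schedulers as weights, and the mass of runs -/

section Runs

variable {Ω : Type*} [Fintype Ω] {E F : Type*} {A : EventStructure Ω E} {B : EventStructure Ω F}

theorem isTrace_snoc {α : List E} {e : E} :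
    A.IsTrace (α ++ [e]) ↔ A.IsTrace α ∧ A.Enabled α e := by
  constructor
  · intro h
    generalize hβ : α ++ [e] = β at h
    cases h with
    | nil => simp at hβ
    | snoc α' e' h h' =>
      obtain ⟨rfl, h1⟩ := List.append_inj' hβ rfl
      cases h1
      exact ⟨h, h'⟩
  · rintro ⟨h, h'⟩
    exact .snoc α e h h'

/-- Weights of a scheduler, extended by `0` to pairs that are not traces. -/
theorem IsScheduler.exists_weight {σ : List E → E → Ω → Ω → ℝ} (h : A.IsScheduler σ) :
    ∃ w : List E → E → Ω → ℝ,
      (∀ α e t, ¬ A.IsTrace (α ++ [e]) → w α e t = 0) ∧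
      (∀ α e t, IsScaled ((A.label e).out t) (w α e t) (σ α e t)) ∧
      (∀ α, A.IsTrace α → ¬ A.IsMaxTrace α → ∀ t, HasSum (fun e => w α e t) 1) := by
  classical
  -- With the trace hypothesis moved under the existential, weights can be chosen for all lists at
  -- once.
  have h2 : ∀ α, ∃ w : E → Ω → ℝ, A.IsTrace α → _ := fun α =>
    (em (A.IsTrace α)).elim (fun ht => (h.2 α ht).imp fun _ hw _ => hw)
      fun ht => ⟨0, fun h => absurd h ht⟩
  choose w hw using h2
  refine ⟨fun α e t => if A.IsTrace (α ++ [e]) then w α e t else 0, fun α e t ht => if_neg ht,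
    fun α e t => ?_, fun α ht hm t => ?_⟩
  · dsimp only
    split_ifs with ht
    · obtain ⟨h1, h2, h3, -⟩ := hw α (isTrace_snoc.1 ht).1
      rcases Set.eq_empty_or_nonempty ((A.label e).out t) with he | he
      · obtain ⟨h4, h5⟩ := h3 e t ht he
        rw [h4, h5]
        exact IsScaled.zero
      · exact ⟨(h1 e t).1, Or.inl (h2 e t ht he)⟩
    · rw [h.1 α e t ht]
      exact IsScaled.zero
  · have := (hw α ht).2.2.2 hm t
    rw [← hasSum_subtype_iff_of_support_subset (s := {e | A.IsTrace (α ++ [e])})]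
    · have heq : (fun e : {e // A.IsTrace (α ++ [e])} => w α e t) =
          fun e : {e // A.IsTrace (α ++ [e])} => if A.IsTrace (α ++ [e.1]) then w α e t else 0 :=
         funext fun e => (if_pos e.2).symm
      rw [heq] at this
      exact this
    · intro e he
      by_contra hc
      exact he (if_neg hc)

/-- Schedulers from weights that are `0` outside the traces. -/
theorem isScheduler_of_weight {σ : List E → E → Ω → Ω → ℝ} (w : List E → E → Ω → ℝ)
    (h0 : ∀ α e t, ¬ A.IsTrace (α ++ [e]) → w α e t = 0)
    (h1 : ∀ α e t, IsScaled ((A.label e).out t) (w α e t) (σ α e t))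
    (h2 : ∀ α, A.IsTrace α → ¬ A.IsMaxTrace α → ∀ t, HasSum (fun e => w α e t) 1) :
    A.IsScheduler σ := by
  have hz : ∀ α e t, ¬ A.IsTrace (α ++ [e]) → σ α e t = 0 := fun α e t ht => by
    have := h1 α e t
    rw [h0 α e t ht] at this
    exact this.eq_zero
  refine ⟨hz, fun α ht => ⟨w α, fun e t => ⟨(h1 α e t).1, ?_⟩, fun e t hte hn => ?_,
    fun e t hte he => ?_, fun hm t => ?_⟩⟩
  -- The bound by 1 is automatic: no weight is left at a maximal trace, and elsewhere the
  -- nonnegative weights sum to 1.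
  · by_cases hm : A.IsMaxTrace α
    · rw [h0 α e t (hm.2 e)]; exact zero_le_one
    · exact le_hasSum (h2 α ht hm t) e fun e' _ => (h1 α e' t).1
  · obtain ⟨-, h | ⟨h, h'⟩⟩ := h1 α e t
    · exact h
    · exact ⟨hn.some, hn.some_mem, by rw [h, h', zero_smul]⟩
  · obtain ⟨-, ⟨μ, hμ, -⟩ | h⟩ := h1 α e t
    · rw [he] at hμ; exact hμ.elim
    · exact h
  · refine (hasSum_subtype_iff_of_support_subset (s := {e | A.IsTrace (α ++ [e])}) ?_).2
      (h2 α ht hm t)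
    intro e he
    by_contra hc
    exact he (h0 _ _ _ hc)

theorem runFrom_snoc (σ : List E → E → Ω → Ω → ℝ) (ν : Ω → ℝ) (α : List E) (e : E) :
    runFrom σ [] ν (α ++ [e]) = fun u => ∑ t, σ α e t u * runFrom σ [] ν α t := by
  have key : ∀ (l β : List E) (μ : Ω → ℝ), runFrom σ β μ (l ++ [e]) =
      fun u => ∑ t, σ (β ++ l) e t u * runFrom σ β μ l t := by
    intro l
    induction l with
    | nil => intro β μ; simp [runFrom]
    | cons a l ih => intro β μ; simp [runFrom, ih]
  simpa using key α [] ν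

theorem sum_dirac (ν : Ω → ℝ) (u : Ω) : ∑ s, ν s * dirac s u = ν u := by
  classical
  have : ∀ s, dirac s u = if s = u then 1 else 0 := fun s => by
    simp [dirac, Pi.single_apply, eq_comm]
  simp [this]

theorem sum_dirac_right (f : Ω → ℝ) (s : Ω) : ∑ t, f t * dirac s t = f s := by
  classical
  have : ∀ t, dirac s t = if t = s then 1 else 0 := fun t => by
    simp [dirac, Pi.single_apply]
  simp [this]

theorem sum_dirac_apply (s : Ω) : ∑ t, dirac s t = 1 := by
  simpa using sum_dirac_right (fun _ => 1) s

/-- Runs depend linearly on the initial weights. -/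
theorem runFrom_eq_sum_run (σ : List E → E → Ω → Ω → ℝ) (ν : Ω → ℝ) (α : List E) (u : Ω) :
    runFrom σ [] ν α u = ∑ s, ν s * run σ s α u := by
  induction α using List.reverseRecOn generalizing u with
  | nil => exact (sum_dirac ν u).symm
  | append_singleton α e ih =>
    rw [runFrom_snoc]
    simp only [run_snoc, ih, Finset.mul_sum]
    rw [Finset.sum_comm]
    refine Finset.sum_congr rfl fun s _ => Finset.sum_congr rfl fun t _ => by ring

theorem IsScheduler.nonneg {σ : List E → E → Ω → Ω → ℝ} (h : A.IsScheduler σ) (α : List E) (e : E)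
    (t u : Ω) : 0 ≤ σ α e t u := by
  obtain ⟨w, -, h1, -⟩ := h.exists_weight
  exact (h1 α e t).apply_nonneg ((A.label e).out_subset t) u

theorem IsScheduler.runFrom_nonneg {σ : List E → E → Ω → Ω → ℝ} (h : A.IsScheduler σ) {ν : Ω → ℝ}
    (hν : ∀ s, 0 ≤ ν s) (α : List E) (u : Ω) : 0 ≤ runFrom σ [] ν α u := by
  induction α using List.reverseRecOn generalizing u with
  | nil => exact hν u
  | append_singleton α e ih =>
    rw [runFrom_snoc]
    exact Finset.sum_nonneg fun t _ => mul_nonneg (h.nonneg _ _ _ _) (ih t)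

omit [Fintype Ω] in
theorem dirac_nonneg (s t : Ω) : 0 ≤ dirac s t := by
  classical
  simp only [dirac, Pi.single_apply]
  split_ifs <;> norm_num

/-- The mass of the maximal traces does not exceed the initial mass. -/
theorem IsScheduler.tsum_mass_le {σ : List E → E → Ω → Ω → ℝ} (h : A.IsScheduler σ) {ν : Ω → ℝ}
    (hν : ∀ s, 0 ≤ ν s) :
    ∑' α : {α // A.IsMaxTrace α}, ENNReal.ofReal (∑ u, runFrom σ [] ν α u) ≤
      ENNReal.ofReal (∑ u, ν u) := by
  classical
  obtain ⟨w, h0, h1, h2⟩ := h.exists_weight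
  set φ := runFrom σ [] ν with hφ
  have hφ0 : ∀ α u, 0 ≤ φ α u := fun α u => h.runFrom_nonneg hν α u
  -- Labels contain distributions only, so a step moves exactly the scheduled mass.
  have hstep : ∀ α e, ∑ u, φ (α ++ [e]) u = ∑ t, w α e t * φ α t := by
    intro α e
    rw [hφ, runFrom_snoc, Finset.sum_comm]
    refine Finset.sum_congr rfl fun t _ => ?_
    rw [← Finset.sum_mul, (h1 α e t).sum_apply ((A.label e).out_subset t)]
  refine (tsum_subtype {α | A.IsMaxTrace α} fun α => ENNReal.ofReal (∑ u, φ α u)).trans_le ?_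
  refine tsum_list_le_of_step (fun α => ENNReal.ofReal (∑ u, φ α u)) _ fun α => ?_
  by_cases hm : A.IsMaxTrace α
  · rw [Set.indicator_of_mem (by exact hm)]
    have : ∀ e, ENNReal.ofReal (∑ u, φ (α ++ [e]) u) = 0 := fun e => by
      rw [hstep]; simp [h0 α e _ (hm.2 e)]
    simp [this]
  · rw [Set.indicator_of_notMem (by exact hm), zero_add]
    by_cases ht : A.IsTrace α
    · have hs : HasSum (fun e => ∑ u, φ (α ++ [e]) u) (∑ u, φ α u) := by
        simp only [hstep]
        refine hasSum_sum fun t _ => ?_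
        simpa using (h2 α ht hm t).mul_right (φ α t)
      rw [← ENNReal.ofReal_tsum_of_nonneg (fun e => Finset.sum_nonneg fun u _ => hφ0 _ u)
        hs.summable, hs.tsum_eq]
    · have : ∀ e, ENNReal.ofReal (∑ u, φ (α ++ [e]) u) = 0 := fun e => by
        rw [hstep]; simp [h0 α e _ fun hc => ht (isTrace_snoc.1 hc).1]
      simp [this]

theorem IsScheduler.summable_mass {σ : List E → E → Ω → Ω → ℝ} (h : A.IsScheduler σ) {ν : Ω → ℝ}
    (hν : ∀ s, 0 ≤ ν s) :
    Summable (fun α : {α // A.IsMaxTrace α} => ∑ u, runFrom σ [] ν α u) := by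
  have h1 := h.tsum_mass_le hν
  have h2 := ENNReal.summable_toReal (ne_top_of_le_ne_top ENNReal.ofReal_ne_top h1)
  refine h2.congr fun α => ?_
  rw [ENNReal.toReal_ofReal (Finset.sum_nonneg fun u _ => h.runFrom_nonneg hν _ _)]

theorem IsScheduler.summable_runFrom {σ : List E → E → Ω → Ω → ℝ} (h : A.IsScheduler σ) {ν : Ω → ℝ}
    (hν : ∀ s, 0 ≤ ν s) (u : Ω) :
    Summable (fun α : {α // A.IsMaxTrace α} => runFrom σ [] ν α u) :=
  Summable.of_nonneg_of_le (fun _ => h.runFrom_nonneg hν _ _)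
    (fun _ => Finset.single_le_sum (f := fun u => runFrom σ [] ν _ u)
      (fun u _ => h.runFrom_nonneg hν _ u) (Finset.mem_univ u)) (h.summable_mass hν)

theorem IsScheduler.hasSum_behaviour {σ : List E → E → Ω → Ω → ℝ} (h : A.IsScheduler σ)
    (s u : Ω) : HasSum (fun α : {α // A.IsMaxTrace α} => run σ s α u) (A.behaviour σ s u) :=
  (h.summable_runFrom (dirac_nonneg s) u).hasSum

theorem IsScheduler.behaviour_nonneg {σ : List E → E → Ω → Ω → ℝ} (h : A.IsScheduler σ)
    (s u : Ω) : 0 ≤ A.behaviour σ s u :=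
  tsum_nonneg fun _ => h.runFrom_nonneg (dirac_nonneg s) _ u

/-- Only an inequality holds in general, since mass can escape along infinite runs. -/
theorem IsScheduler.sum_behaviour_le {σ : List E → E → Ω → Ω → ℝ} (h : A.IsScheduler σ)
    (s : Ω) : ∑ u, A.behaviour σ s u ≤ 1 := by
  have h1 : HasSum (fun α : {α // A.IsMaxTrace α} => ∑ u, runFrom σ [] (dirac s) α u)
      (∑ u, A.behaviour σ s u) := hasSum_sum fun u _ => h.hasSum_behaviour s u
  have h2 := h.tsum_mass_le (dirac_nonneg s)
  rw [← ENNReal.ofReal_tsum_of_nonneg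
    (fun α => Finset.sum_nonneg fun u _ => h.runFrom_nonneg (dirac_nonneg s) _ _) h1.summable,
    h1.tsum_eq, sum_dirac_apply, ENNReal.ofReal_le_ofReal_iff zero_le_one] at h2
  exact h2

theorem IsScheduler.hasSum_runFrom {σ : List E → E → Ω → Ω → ℝ} (h : A.IsScheduler σ)
    (ν : Ω → ℝ) (u : Ω) : HasSum (fun α : {α // A.IsMaxTrace α} => runFrom σ [] ν α u)
      (∑ s, ν s * A.behaviour σ s u) := by
  simp only [runFrom_eq_sum_run]
  exact hasSum_sum fun s _ => (h.hasSum_behaviour s u).mul_left _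

/-- A consistent assignment of masses to the traces and of flows to their one-event extensions is
the run of a scheduler. -/
theorem exists_isScheduler_of_flow
    (hB : ∀ β, B.IsTrace β → ¬ B.IsMaxTrace β → ∀ t,
      ∃ e, B.IsTrace (β ++ [e]) ∧ ((B.label e).out t).Nonempty)
    (m : List F → Ω → ℝ) (x : List F → F → Ω → ℝ) (fl : List F → F → Ω → Ω → ℝ)
    (hm : ∀ β t, 0 ≤ m β t)
    (hx0 : ∀ β e t, ¬ B.IsTrace (β ++ [e]) → x β e t = 0)
    (hx : ∀ β e t, IsScaled ((B.label e).out t) (x β e t) (fl β e t))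
    (hsum : ∀ β, B.IsTrace β → ¬ B.IsMaxTrace β → ∀ t, HasSum (fun e => x β e t) (m β t))
    (hfl : ∀ β e u, B.IsTrace (β ++ [e]) → m (β ++ [e]) u = ∑ t, fl β e t u) :
    ∃ τ, B.IsScheduler τ ∧ ∀ β, B.IsTrace β → runFrom τ [] (m []) β = m β := by
  classical
  -- Local normalisation: the weights are the flows divided by the mass `m β t`, that is,
  -- conditional probabilities.
  have hloc : ∀ β t, ∃ (w : F → ℝ) (v : F → Ω → ℝ),
      (∀ e, ¬ B.IsTrace (β ++ [e]) → w e = 0) ∧ (∀ e, IsScaled ((B.label e).out t) (w e) (v e)) ∧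
      (B.IsTrace β → ¬ B.IsMaxTrace β → HasSum w 1) ∧
      (∀ e, B.IsTrace (β ++ [e]) → m β t • v e = fl β e t) := by
    intro β t
    by_cases hβ : B.IsTrace β ∧ ¬ B.IsMaxTrace β
    swap
    · refine ⟨0, 0, fun _ _ => rfl, fun _ => IsScaled.zero, fun h1 h2 => absurd ⟨h1, h2⟩ hβ,
        fun e he => absurd ⟨(isTrace_snoc.1 he).1, fun hc => hc.2 e he⟩ hβ⟩
    obtain ⟨hβ, hβm⟩ := hβ
    by_cases h0 : m β t = 0
    -- Nothing arrives in state `t`, so any legal move will do; `hB` is needed exactly here. All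
    -- flows out of `t` vanish, being nonnegative with sum zero.
    · obtain ⟨e₀, he₀, μ, hμ⟩ := hB β hβ hβm t
      refine ⟨Pi.single e₀ 1, Pi.single e₀ μ, fun e he => ?_, fun e => ?_,
        fun _ _ => hasSum_pi_single e₀ 1, fun e he => ?_⟩
      · exact Pi.single_eq_of_ne (by rintro rfl; exact he he₀) _
      · rcases eq_or_ne e e₀ with rfl | hne
        · simpa using IsScaled.of_mem hμ
        · simpa [Pi.single_eq_of_ne hne] using IsScaled.zero
      · have h1 : x β e t = 0 := le_antisymm
          (h0 ▸ le_hasSum (hsum β hβ hβm t) e fun e' _ => (hx β e' t).1) (hx β e t).1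
        have h2 := hx β e t
        rw [h1] at h2
        rw [h0, zero_smul, h2.eq_zero]
    · refine ⟨fun e => (m β t)⁻¹ * x β e t, fun e => (m β t)⁻¹ • fl β e t, fun e he => ?_,
        fun e => (hx β e t).smul (inv_nonneg.2 (hm β t)), fun _ _ => ?_, fun e _ => ?_⟩
      · simp [hx0 β e t he]
      · simpa [h0] using (hsum β hβ hβm t).mul_left (m β t)⁻¹
      · rw [smul_smul, mul_inv_cancel₀ h0, one_smul]
  choose w v h0 h1 h2 h3 using hloc
  refine ⟨fun β e t => v β t e, isScheduler_of_weight (fun β e t => w β t e)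
    (fun β e t => h0 β t e) (fun β e t => h1 β t e) (fun β hβ hβm t => h2 β t hβ hβm), ?_⟩
  intro β
  induction β using List.reverseRecOn with
  | nil => intro _; rfl
  | append_singleton β e ih =>
    intro hβ
    rw [runFrom_snoc, ih (isTrace_snoc.1 hβ).1]
    funext u
    rw [hfl β e u hβ]
    refine Finset.sum_congr rfl fun t _ => ?_
    rw [← h3 β t e hβ, Pi.smul_apply, smul_eq_mul, mul_comm]

end Runs

end EventStructure

end RelyGuarantee

namespace RelyGuarantee

namespace EventStructure

/-! ### Transport of schedulers along maps of traces -/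

section Reduction

variable {Ω : Type*} [Fintype Ω] {E F : Type*} {A : EventStructure Ω E} {B : EventStructure Ω F}

theorem hasSum_of_fiberwise {ι κ : Type*} {y : ι → ℝ} {a : ℝ} (hy : HasSum y a) (g : ι → κ)
    {b : κ → ℝ} (hb : ∀ c, HasSum (({i | g i = c} : Set ι).indicator y) (b c)) : HasSum b a :=
  ((Equiv.sigmaFiberEquiv g).hasSum_iff.2 hy).sigma fun c =>
    (hasSum_subtype_iff_indicator (s := {i | g i = c})).2 (hb c)

theorem prob_eq (μ : Ω → ℝ) (O : Set Ω) [DecidablePred (· ∈ O)] :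
    prob μ O = ∑ u, if u ∈ O then μ u else 0 := by
  simp [prob, Set.indicator_apply]

/-- A map of traces with finite fibres that mirrors each event or, if it is ineffectual, drops it,
such that after the image of a maximal trace `B` can terminate by the ineffectual event chosen by
`d`, but never terminates before. -/
structure IsReduction (A : EventStructure Ω E) (B : EventStructure Ω F) (f : List E → List F)
    (d : List F → F) : Prop where
  map_nil : f [] = []
  isTrace : ∀ α, A.IsTrace α → B.IsTrace (f α)
  finite_fiber : ∀ β, {α | A.IsTrace α ∧ f α = β}.Finite
  step : ∀ α e, A.IsTrace (α ++ [e]) →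
    (f (α ++ [e]) = f α ∧ (A.label e).Refines Prog.skip) ∨
    ∃ e', (A.label e).Refines (B.label e') ∧ f (α ++ [e]) = f α ++ [e']
  not_isMaxTrace : ∀ α, A.IsTrace α → ¬ B.IsMaxTrace (f α)
  isMaxTrace_snoc : ∀ α, A.IsMaxTrace α → B.IsMaxTrace (f α ++ [d (f α)]) ∧
    Prog.skip.Refines (B.label (d (f α)))

namespace IsReduction

variable {f : List E → List F} {d : List F → F}

/-- The traces with a given image. -/
noncomputable def fiber (h : IsReduction A B f d) (β : List F) : Finset (List E) :=
  (h.finite_fiber β).toFinset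

theorem mem_fiber (h : IsReduction A B f d) {β : List F} {α : List E} :
    α ∈ h.fiber β ↔ A.IsTrace α ∧ f α = β := by
  simp [fiber]

theorem finite_ext (h : IsReduction A B f d) (α : List E) (β : List F) :
    {e | A.IsTrace (α ++ [e]) ∧ f (α ++ [e]) = β}.Finite :=
  (h.finite_fiber β).preimage (f := fun e => α ++ [e]) fun a _ b _ hab => by simpa using hab

/-- The events by which a trace can be extended to a trace with a given image. -/
noncomputable def ext (h : IsReduction A B f d) (α : List E) (β : List F) : Finset E :=
  (h.finite_ext α β).toFinset

theorem mem_ext (h : IsReduction A B f d) {α : List E} {β : List F} {e : E} :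
    e ∈ h.ext α β ↔ A.IsTrace (α ++ [e]) ∧ f (α ++ [e]) = β := by
  simp [ext]

theorem refines_of_mem_ext_snoc (h : IsReduction A B f d) {α : List E} {β : List F} {e : E} {e' : F}
    (hα : f α = β) (he : e ∈ h.ext α (β ++ [e'])) : (A.label e).Refines (B.label e') := by
  obtain ⟨h1, h2⟩ := h.mem_ext.1 he
  rcases h.step α e h1 with ⟨h3, -⟩ | ⟨e'', h3, h4⟩
  · rw [h3, hα] at h2
    simp at h2
  · rw [h4, hα] at h2
    obtain rfl : e'' = e' := by simpa using h2
    exact h3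

theorem refines_skip_of_mem_ext (h : IsReduction A B f d) {α : List E} {e : E}
    (he : e ∈ h.ext α (f α)) : (A.label e).Refines Prog.skip := by
  obtain ⟨h1, h2⟩ := h.mem_ext.1 he
  rcases h.step α e h1 with ⟨-, h3⟩ | ⟨e'', h3, h4⟩
  · exact h3
  · rw [h4] at h2
    simp at h2

/-- Reindexing by the last event: a nonempty trace is its predecessor together with one extension.
-/
theorem sum_fiber_filter (h : IsReduction A B f d) (β β' : List F) (φ : List E → ℝ)
    [DecidablePred fun α : List E => α ≠ [] ∧ f α.dropLast = β'] :
    ∑ α ∈ h.fiber β with α ≠ [] ∧ f α.dropLast = β', φ α =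
      ∑ α ∈ h.fiber β', ∑ e ∈ h.ext α β, φ (α ++ [e]) := by
  rw [Finset.sum_sigma']
  symm
  refine Finset.sum_bij (fun p _ => p.1 ++ [p.2]) ?_ ?_ ?_ ?_
  · rintro ⟨α, e⟩ hp
    obtain ⟨h1, h2⟩ := Finset.mem_sigma.1 hp
    rw [Finset.mem_filter, h.mem_fiber]
    exact ⟨h.mem_ext.1 h2, by simp, by simpa using (h.mem_fiber.1 h1).2⟩
  · rintro ⟨α, e⟩ - ⟨α', e'⟩ - heq
    obtain ⟨rfl, h1⟩ := List.append_inj' heq rfl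
    cases h1
    rfl
  · intro α hα
    obtain ⟨h1, h2, h3⟩ := Finset.mem_filter.1 hα
    obtain ⟨h4, h5⟩ := h.mem_fiber.1 h1
    have heq := List.dropLast_append_getLast h2
    refine ⟨⟨α.dropLast, α.getLast h2⟩, ?_, heq⟩
    rw [← heq] at h4 h5
    exact Finset.mem_sigma.2 ⟨h.mem_fiber.2 ⟨(isTrace_snoc.1 h4).1, h3⟩, h.mem_ext.2 ⟨h4, h5⟩⟩
  · intro _ _
    rfl

/-- Apart from the empty trace, every trace over `[]` arises by a dropped event from another one
over `[]`. -/
theorem sum_fiber_nil (h : IsReduction A B f d) (φ : List E → ℝ) : ∑ α ∈ h.fiber [], φ α =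
    φ [] + ∑ α ∈ h.fiber [], ∑ e ∈ h.ext α [], φ (α ++ [e]) := by
  classical
  rw [← h.sum_fiber_filter [] []]
  have h0 : [] ∈ h.fiber [] := h.mem_fiber.2 ⟨.nil, h.map_nil⟩
  rw [← Finset.add_sum_erase _ _ h0]
  congr 2
  ext α
  simp only [Finset.mem_erase, Finset.mem_filter]
  constructor
  · rintro ⟨h1, h2⟩
    refine ⟨h2, h1, ?_⟩
    obtain ⟨h3, h4⟩ := h.mem_fiber.1 h2
    rw [← List.dropLast_append_getLast h1] at h3 h4
    rcases h.step _ _ h3 with ⟨h5, -⟩ | ⟨e', -, h5⟩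
    · rw [← h5, h4]
    · rw [h5] at h4; simp at h4
  · rintro ⟨h1, h2, -⟩
    exact ⟨h2, h1⟩

/-- A trace over `β ++ [e']` either enters this fibre from the fibre of `β` or stays in it by a
dropped event. -/
theorem sum_fiber_snoc (h : IsReduction A B f d) (β : List F) (e' : F) (φ : List E → ℝ) :
    ∑ α ∈ h.fiber (β ++ [e']), φ α =
    ∑ α ∈ h.fiber β, ∑ e ∈ h.ext α (β ++ [e']), φ (α ++ [e]) +
      ∑ α ∈ h.fiber (β ++ [e']), ∑ e ∈ h.ext α (β ++ [e']), φ (α ++ [e]) := by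
  classical
  rw [← h.sum_fiber_filter, ← h.sum_fiber_filter, ← Finset.sum_union]
  · refine Finset.sum_congr ?_ fun _ _ => rfl
    ext α
    simp only [Finset.mem_union, Finset.mem_filter]
    constructor
    · intro h2
      obtain ⟨h3, h4⟩ := h.mem_fiber.1 h2
      have h1 : α ≠ [] := by
        rintro rfl
        rw [h.map_nil] at h4
        simp at h4
      rw [← List.dropLast_append_getLast h1] at h3 h4
      rcases h.step _ _ h3 with ⟨h5, -⟩ | ⟨e'', -, h5⟩
      · exact Or.inr ⟨h2, h1, h5.symm.trans h4⟩
      · rw [h5] at h4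
        exact Or.inl ⟨h2, h1, (List.append_inj' h4 rfl).1⟩
    · rintro (h1 | h1) <;> exact h1.1
  · rw [Finset.disjoint_left]
    intro α h1 h2
    have h3 := (Finset.mem_filter.1 h1).2.2
    rw [(Finset.mem_filter.1 h2).2.2] at h3
    simp at h3

/-- A function on events, restricted to the extensions of a trace, is summed along the events of
the image. -/
theorem hasSum_ext (h : IsReduction A B f d) {α : List E} {y : E → ℝ} {a : ℝ} (hy : HasSum y a)
    (h0 : ∀ e, ¬ A.IsTrace (α ++ [e]) → y e = 0) :
    HasSum (fun e' => ∑ e ∈ h.ext α (f α ++ [e']), y e) (a - ∑ e ∈ h.ext α (f α), y e) := by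
  classical
  -- The value `d []` is a dummy for events that are dropped or not enabled; these contribute 0
  -- after the subtraction in `h2`.
  have hg : ∀ e, ∃ e', A.IsTrace (α ++ [e]) → f (α ++ [e]) ≠ f α → f (α ++ [e]) = f α ++ [e'] := by
    intro e
    by_cases ht : A.IsTrace (α ++ [e])
    · rcases h.step α e ht with ⟨h1, -⟩ | ⟨e', -, h1⟩
      · exact ⟨d [], fun _ hc => absurd h1 hc⟩
      · exact ⟨e', fun _ _ => h1⟩
    · exact ⟨d [], fun hc => absurd hc ht⟩
  choose g hg using hg
  have h1 : HasSum (fun e => if e ∈ h.ext α (f α) then y e else 0) (∑ e ∈ h.ext α (f α), y e) := by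
    rw [← Finset.sum_congr rfl fun e (he : e ∈ h.ext α (f α)) =>
      if_pos (c := e ∈ h.ext α (f α)) (e := (0 : ℝ)) he]
    exact hasSum_sum_of_ne_finset_zero fun e he => if_neg he
  have h2 := hy.sub h1
  refine hasSum_of_fiberwise h2 g fun e' => ?_
  · have key : ∀ e ∈ h.ext α (f α ++ [e']), ({e | g e = e'} : Set E).indicator
        (fun e => y e - if e ∈ h.ext α (f α) then y e else 0) e = y e := by
      intro e he
      obtain ⟨h4, h5⟩ := h.mem_ext.1 he
      have h6 : f (α ++ [e]) ≠ f α := by rw [h5]; simp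
      have h7 := hg e h4 h6
      rw [h5] at h7
      have h8 : g e = e' := by simpa using h7.symm
      rw [Set.indicator_of_mem (by exact h8), if_neg, sub_zero]
      exact fun hc => h6 (h.mem_ext.1 hc).2
    rw [← Finset.sum_congr rfl key]
    refine hasSum_sum_of_ne_finset_zero fun e he => ?_
    by_cases h8 : g e = e'
    · rw [Set.indicator_of_mem (by exact h8)]
      by_cases ht : A.IsTrace (α ++ [e])
      · by_cases hs : f (α ++ [e]) = f α
        · rw [if_pos (h.mem_ext.2 ⟨ht, hs⟩), sub_self]
        · exact absurd (h.mem_ext.2 ⟨ht, h8 ▸ hg e ht hs⟩) he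
      · simp [h0 e ht]
    · exact Set.indicator_of_notMem (by exact h8) _

open Classical in
/-- A reduction carries over the schedulers, with the same behaviour from given initial weights. -/
theorem exists_isScheduler (h : IsReduction A B f d)
    (hB : ∀ β, B.IsTrace β → ¬ B.IsMaxTrace β → ∀ t,
      ∃ e, B.IsTrace (β ++ [e]) ∧ ((B.label e).out t).Nonempty)
    {σ : List E → E → Ω → Ω → ℝ} (hσ : A.IsScheduler σ) {ν : Ω → ℝ} (hν : ∀ s, 0 ≤ ν s) :
    ∃ τ, B.IsScheduler τ ∧
      ∀ u, ∑ s, ν s * B.behaviour τ s u = ∑ s, ν s * A.behaviour σ s u := by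
  obtain ⟨w, hw0, hw1, hw2⟩ := hσ.exists_weight
  obtain ⟨φ, hφ⟩ : ∃ φ, φ = runFrom σ [] ν := ⟨_, rfl⟩
  have hφ0 : ∀ α u, 0 ≤ φ α u := fun α u => hφ ▸ hσ.runFrom_nonneg hν α u
  have hφs : ∀ α e u, φ (α ++ [e]) u = ∑ t, φ α t * σ α e t u := fun α e u => by
    rw [hφ, runFrom_snoc]
    exact Finset.sum_congr rfl fun t _ => mul_comm _ _
  -- `K β` is the mass that `σ` stops with inside the fibre of `β`. In `B` it has to leave by the
  -- event `d β`.
  obtain ⟨K, hK⟩ : ∃ K : List F → Ω → ℝ,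
    ∀ β t, K β t = ∑ α ∈ h.fiber β, if A.IsMaxTrace α then φ α t else 0 := ⟨_, fun _ _ => rfl⟩
  have hK0 : ∀ β t, 0 ≤ K β t := fun β t => by
    rw [hK]
    exact Finset.sum_nonneg fun α _ => by split_ifs <;> simp [hφ0]
  have hKz : ∀ β, (¬ B.IsMaxTrace (β ++ [d β]) ∨ ¬ Prog.skip.Refines (B.label (d β))) →
      ∀ t, K β t = 0 := fun β hβ t => by
    rw [hK]
    refine Finset.sum_eq_zero fun α hα => if_neg fun hc => ?_
    have := h.isMaxTrace_snoc α hc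
    rw [(h.mem_fiber.1 hα).2] at this
    tauto
  -- The scalar flow `x` and its output `fl` collect all steps of `A` that leave the fibre of `β` by
  -- `e'`, plus the stopped mass along `d β`.
  obtain ⟨x, hx⟩ : ∃ x : List F → F → Ω → ℝ, ∀ β e' t, x β e' t =
    ∑ α ∈ h.fiber β, ∑ e ∈ h.ext α (β ++ [e']), φ α t * w α e t +
      if e' = d β then K β t else 0 := ⟨_, fun _ _ _ => rfl⟩
  obtain ⟨fl, hfl⟩ : ∃ fl : List F → F → Ω → Ω → ℝ, ∀ β e' t, fl β e' t =
    ∑ α ∈ h.fiber β, ∑ e ∈ h.ext α (β ++ [e']), φ α t • σ α e t +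
      if e' = d β then K β t • dirac t else 0 := ⟨_, fun _ _ _ => rfl⟩
  -- `m β` is the mass entering the fibre of `β`. The total mass of the traces in the fibre would
  -- count the same mass again after each dropped event.
  obtain ⟨m, hm⟩ : ∃ m : List F → Ω → ℝ, ∀ β u, m β u =
    if hβ : β = [] then ν u else ∑ t, fl β.dropLast (β.getLast hβ) t u := ⟨_, fun _ _ => rfl⟩
  have hm_nil : m [] = ν := funext fun u => by rw [hm, dif_pos rfl]
  have hm_snoc : ∀ β e' u, m (β ++ [e']) u = ∑ t, fl β e' t u := fun β e' u => by
    rw [hm, dif_neg (by simp)]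
    simp
  have hm_eq : ∀ β e' u, m (β ++ [e']) u =
      ∑ α ∈ h.fiber β, ∑ e ∈ h.ext α (β ++ [e']), φ (α ++ [e]) u +
        if e' = d β then K β u else 0 := fun β e' u => by
    simp only [hm_snoc, hfl, hφs, Pi.add_apply, Finset.sum_apply, Finset.sum_add_distrib]
    congr 1
    · rw [Finset.sum_comm]
      refine Finset.sum_congr rfl fun α _ => ?_
      rw [Finset.sum_comm]
      rfl
    · split_ifs
      · exact sum_dirac (K β) u
      · simp
  have hxfl : ∀ β e' t, IsScaled ((B.label e').out t) (x β e' t) (fl β e' t) := by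
    intro β e' t
    rw [hx, hfl]
    have hc := (B.label e').convex_out t
    refine IsScaled.add hc (IsScaled.sum hc _ fun α hα => IsScaled.sum hc _ fun e he => ?_) ?_
    · exact ((hw1 α e t).mono (h.refines_of_mem_ext_snoc (h.mem_fiber.1 hα).2 he t)).smul (hφ0 α t)
    · split_ifs with hd
      · by_cases hs : Prog.skip.Refines (B.label (d β))
        · rw [hd]
          simpa using (IsScaled.of_mem (hs t (Set.mem_singleton _))).smul (hK0 β t)
        · rw [hKz β (Or.inr hs) t, zero_smul]
          exact IsScaled.zero
      · exact IsScaled.zero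
  have hx0 : ∀ β e' t, ¬ B.IsTrace (β ++ [e']) → x β e' t = 0 := by
    intro β e' t ht
    rw [hx]
    have h1 : ∀ α, h.ext α (β ++ [e']) = ∅ := fun α =>
        Finset.eq_empty_of_forall_notMem fun e he => by
      obtain ⟨h2, h3⟩ := h.mem_ext.1 he
      exact ht (h3 ▸ h.isTrace _ h2)
    simp only [h1, Finset.sum_empty, Finset.sum_const_zero, zero_add]
    split_ifs with hd
    · subst hd
      exact hKz β (Or.inl fun hc => ht hc.1) t
    · rfl
  -- Balance inside a fibre: what is present at its traces has either entered or come by a dropped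
  -- event. If `β` is maximal, stopped mass enters as well, hence the exclusion.
  have henter : ∀ β, ¬ B.IsMaxTrace β → ∀ u, ∑ α ∈ h.fiber β, φ α u =
      m β u + ∑ α ∈ h.fiber β, ∑ e ∈ h.ext α β, φ (α ++ [e]) u := by
    intro β hβ u
    induction β using List.reverseRecOn with
    | nil => rw [h.sum_fiber_nil, hm_nil, hφ]; rfl
    | append_singleton β e' =>
      rw [h.sum_fiber_snoc, hm_eq]
      split_ifs with hd
      · subst hd
        rw [hKz β (Or.inl hβ), add_zero]
      · rw [add_zero]
  -- A label refining `skip` can only return the current state, so dropped events move mass within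
  -- the fibre state by state.
  have hstay : ∀ α, ∀ e ∈ h.ext α (f α), ∀ u, φ (α ++ [e]) u = φ α u * w α e u := by
    intro α e he u
    have h1 : ∀ t, σ α e t = w α e t • dirac t := fun t =>
      ((hw1 α e t).mono (h.refines_skip_of_mem_ext he t)).eq_smul_dirac
    rw [hφs, ← sum_dirac (fun t => φ α t * w α e t)]
    refine Finset.sum_congr rfl fun t _ => ?_
    rw [h1, Pi.smul_apply, smul_eq_mul, mul_assoc]
  -- Outflow equals inflow: at each trace the outgoing mass is the present mass minus the stopped
  -- and the staying mass. Summed over the fibre, `henter` cancels the staying mass, and the stopped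
  -- mass returns through `d β`.
  have hsum : ∀ β, B.IsTrace β → ¬ B.IsMaxTrace β → ∀ t, HasSum (fun e => x β e t) (m β t) := by
    intro β _ hβm t
    have h1 : ∀ α ∈ h.fiber β, HasSum (fun e' => ∑ e ∈ h.ext α (β ++ [e']), φ α t * w α e t)
        ((φ α t - if A.IsMaxTrace α then φ α t else 0) - ∑ e ∈ h.ext α β, φ (α ++ [e]) t) := by
      intro α hα
      obtain ⟨htr, rfl⟩ := h.mem_fiber.1 hα
      rw [Finset.sum_congr rfl fun e he => hstay α e he t]
      refine h.hasSum_ext ?_ fun e he => by rw [hw0 α e t he, mul_zero]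
      split_ifs with hmax
      · simp [hw0 α _ t (hmax.2 _), hasSum_zero]
      · simpa using (hw2 α htr hmax t).mul_left (φ α t)
    have h2 := (hasSum_sum h1).add (hasSum_ite_eq (d β) (K β t))
    simp only [hx]
    convert h2 using 1
    simp only [Finset.sum_sub_distrib]
    rw [← hK, henter β hβm]
    ring
  obtain ⟨τ, hτ, hτm⟩ := exists_isScheduler_of_flow hB m x fl
    (fun β t => by
      rw [hm]
      split_ifs
      · exact hν t
      · exact Finset.sum_nonneg fun t' _ =>
          (hxfl _ _ t').apply_nonneg ((B.label _).out_subset t') t)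
    hx0 hxfl hsum fun β e u _ => hm_snoc β e u
  refine ⟨τ, hτ, fun u => ?_⟩
  have hs1 := hτ.hasSum_runFrom ν u
  have hs2 : HasSum ({α | A.IsMaxTrace α}.indicator fun α => runFrom σ [] ν α u) _ :=
    (hasSum_subtype_iff_indicator (s := {α | A.IsMaxTrace α})).1 (hσ.hasSum_runFrom ν u)
  have hs3 : HasSum ({β | B.IsMaxTrace β}.indicator fun β => runFrom τ [] ν β u) _ :=
    (hasSum_subtype_iff_indicator (s := {β | B.IsMaxTrace β})).1 hs1
  -- Maximal traces of `A` are grouped by the maximal trace of `B` in which their mass ends.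
  refine hs3.unique (hasSum_of_fiberwise hs2 (fun α => f α ++ [d (f α)]) fun β => ?_)
  by_cases hβ : B.IsMaxTrace β
  · rw [Set.indicator_of_mem (by exact hβ)]
    rw [← hm_nil, hτm β hβ.1]
    have hne : β ≠ [] := by
      rintro rfl
      exact h.not_isMaxTrace [] .nil (by rwa [h.map_nil])
    obtain ⟨β, e', rfl⟩ : ∃ β' e', β = β' ++ [e'] :=
      ⟨_, _, (List.dropLast_append_getLast hne).symm⟩
    -- No image is maximal, so mass reaches a maximal trace of `B` through the closing event only.
    have h1 : ∀ α, h.ext α (β ++ [e']) = ∅ := fun α =>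
        Finset.eq_empty_of_forall_notMem fun e he => by
      obtain ⟨h2, h3⟩ := h.mem_ext.1 he
      exact h.not_isMaxTrace _ h2 (h3 ▸ hβ)
    rw [hm_eq]
    simp only [h1, Finset.sum_empty, Finset.sum_const_zero, zero_add]
    have hcond : ∀ α, f α ++ [d (f α)] = β ++ [e'] ↔ f α = β ∧ e' = d β := by
      intro α
      constructor
      · intro hc
        obtain ⟨rfl, h3⟩ := List.append_inj' hc rfl
        exact ⟨rfl, by simpa using h3.symm⟩
      · rintro ⟨rfl, rfl⟩
        rfl
    split_ifs with hd
    · rw [hK, Finset.sum_congr rfl (g := ({α | f α ++ [d (f α)] = β ++ [e']} : Set _).indicator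
        ({α | A.IsMaxTrace α}.indicator fun α => runFrom σ [] (m []) α u))]
      · refine hasSum_sum_of_ne_finset_zero fun α hα => ?_
        by_cases h2 : f α ++ [d (f α)] = β ++ [e']
        · rw [Set.indicator_of_mem (by exact h2), Set.indicator_of_notMem]
          exact fun h3 => hα (h.mem_fiber.2 ⟨h3.1, ((hcond α).1 h2).1⟩)
        · exact Set.indicator_of_notMem (by exact h2) _
      · intro α hα
        rw [Set.indicator_of_mem (by exact (hcond α).2 ⟨(h.mem_fiber.1 hα).2, hd⟩),
          Set.indicator_apply, hφ, hm_nil]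
        rfl
    · convert hasSum_zero with α
      exact Set.indicator_of_notMem (s := {α | f α ++ [d (f α)] = β ++ [e']})
        (fun h2 => hd ((hcond α).1 h2).2) _
  · rw [Set.indicator_of_notMem (by exact hβ)]
    convert hasSum_zero with α
    by_cases h2 : f α ++ [d (f α)] = β
    · rw [Set.indicator_of_mem (by exact h2), Set.indicator_of_notMem]
      exact fun h3 => hβ (h2 ▸ (h.isMaxTrace_snoc α h3).1)
    · exact Set.indicator_of_notMem (by exact h2) _

/-- A reduction carries back the lower bounds of probabilities. -/
theorem le_prob_behaviour (h : IsReduction A B f d)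
    (hB : ∀ β, B.IsTrace β → ¬ B.IsMaxTrace β → ∀ t,
      ∃ e, B.IsTrace (β ++ [e]) ∧ ((B.label e).out t).Nonempty)
    {σ : List E → E → Ω → Ω → ℝ} (hσ : A.IsTerminatingScheduler σ) {s₀ : Ω} {O : Set Ω} {p : ℝ}
    (hp : B.SemGe s₀ O p) : p ≤ prob (A.behaviour σ s₀) O := by
  classical
  refine le_of_forall_pos_le_add fun ε hε => ?_
  obtain ⟨c, hc, hcε⟩ : ∃ c : ℝ, 0 < c ∧ c * Fintype.card Ω ≤ ε := by
    have : (0 : ℝ) < Fintype.card Ω := by exact_mod_cast Fintype.card_pos_iff.2 ⟨s₀⟩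
    exact ⟨ε / Fintype.card Ω, by positivity, by field_simp; exact le_rfl⟩
  -- The point mass at `s₀`, perturbed so that every state has positive weight. Normalisation is not
  -- needed, because runs are linear in the initial weights.
  set ν : Ω → ℝ := fun s => c + if s = s₀ then 1 else 0 with hνdef
  have hν : ∀ s, 0 < ν s := fun s => by
    simp only [hνdef]
    split_ifs <;> positivity
  obtain ⟨τ, hτ, heq⟩ := h.exists_isScheduler hB hσ.1 fun s => (hν s).le
  -- Each mass is at most 1 and the averages with positive weights agree with those of masses 1, so
  -- no state can lose mass.
  have hmass : ∀ s, ∑ u, B.behaviour τ s u = 1 := by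
    have h1 : ∑ s, ν s * (∑ u, B.behaviour τ s u) = ∑ s, ν s * 1 := by
      have h2 : ∑ s, ν s * (∑ u, A.behaviour σ s u) = ∑ s, ν s * 1 :=
        Finset.sum_congr rfl fun s _ => by rw [(hσ.2 s).2]
      rw [← h2]
      simp only [Finset.mul_sum]
      rw [Finset.sum_comm, Finset.sum_congr rfl fun u _ => heq u, Finset.sum_comm]
    intro s
    have := (Finset.sum_eq_sum_iff_of_le fun s _ =>
      mul_le_mul_of_nonneg_left (hτ.sum_behaviour_le s) (hν s).le).1 h1 s (Finset.mem_univ s)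
    exact mul_left_cancel₀ (hν s).ne' this
  have hτt : B.IsTerminatingScheduler τ :=
    ⟨hτ, fun s => ⟨fun u => hτ.behaviour_nonneg s u, hmass s⟩⟩
  have h1 : p ≤ prob (B.behaviour τ s₀) O :=
    hp _ (subset_closure (subset_convexHull ℝ _ ⟨τ, hτt, rfl⟩))
  have h2 : ∑ s, ν s * prob (B.behaviour τ s) O = ∑ s, ν s * prob (A.behaviour σ s) O := by
    simp only [prob_eq, Finset.mul_sum]
    rw [Finset.sum_comm]
    conv_rhs => rw [Finset.sum_comm]
    refine Finset.sum_congr rfl fun u _ => ?_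
    split_ifs
    · exact heq u
    · simp
  have h3 : ∀ g : Ω → ℝ, ∑ s, ν s * g s = c * ∑ s, g s + g s₀ := fun g => by
    simp [hνdef, add_mul, Finset.sum_add_distrib, Finset.mul_sum]
  rw [h3, h3] at h2
  have h4 : 0 ≤ ∑ s, prob (B.behaviour τ s) O := Finset.sum_nonneg fun s _ =>
    Finset.sum_nonneg fun u _ => Set.indicator_nonneg (fun u _ => hτ.behaviour_nonneg s u) u
  have h5 : ∑ s, prob (A.behaviour σ s) O ≤ Fintype.card Ω := by
    have : ∀ s ∈ Finset.univ, prob (A.behaviour σ s) O ≤ 1 := fun s _ => by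
      rw [← (hσ.2 s).2]
      exact Finset.sum_le_sum fun u _ => Set.indicator_le_self' (fun _ _ => (hσ.2 s).1 _) u
    simpa using Finset.sum_le_sum this
  -- The other initial states change the probability at `s₀` by at most `c * |Ω| ≤ ε`.
  nlinarith [mul_le_mul_of_nonneg_left h5 hc.le, mul_nonneg hc.le h4]

end IsReduction

end Reduction

end EventStructure

end RelyGuarantee

namespace RelyGuarantee

/-! ### Traces of `r^*` and of concurrent compositions -/

/-- The events of the first `n` copies of `r` in `r^*`. -/
def rep (n : ℕ) : List (ℕ × (Unit ⊕ Unit)) := (List.range n).map fun k => (k, .inl ())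

theorem rep_succ (n : ℕ) : rep (n + 1) = rep n ++ [(n, .inl ())] := by
  simp [rep, List.range_succ]

theorem length_rep (n : ℕ) : (rep n).length = n := by simp [rep]

theorem mem_rep {n : ℕ} {a : ℕ × (Unit ⊕ Unit)} : a ∈ rep n ↔ a.1 < n ∧ a.2 = .inl () := by
  obtain ⟨j, b⟩ := a
  simp only [rep, List.mem_map, List.mem_range, Prod.mk.injEq]
  constructor
  · rintro ⟨k, hk, rfl, rfl⟩
    exact ⟨hk, rfl⟩
  · rintro ⟨h1, h2⟩
    exact ⟨j, h1, rfl, h2.symm⟩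

/-- The number of copies of `r` among the events of a list. -/
def repCount (l : List (ℕ × (Unit ⊕ Unit))) : ℕ := l.countP fun a => a.2.isLeft

theorem repCount_rep (n : ℕ) : repCount (rep n) = n := by
  induction n with
  | zero => rfl
  | succ n ih => rw [rep_succ, repCount, List.countP_append]; simpa [repCount] using ih

theorem repCount_snoc_inl (l : List (ℕ × (Unit ⊕ Unit))) (j : ℕ) (x : Unit) :
    repCount (l ++ [(j, .inl x)]) = repCount l + 1 := by
  simp [repCount, List.countP_append]

theorem repCount_snoc_inr (l : List (ℕ × (Unit ⊕ Unit))) (j : ℕ) (x : Unit) :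
    repCount (l ++ [(j, .inr x)]) = repCount l := by
  simp [repCount, List.countP_append]

namespace EventStructure

section Traces

variable {Ω : Type*} [Fintype Ω] {E F X : Type*}

/-- Bundles rule out indices above `n`. Below `n`, the copy of `r` has occurred and conflicts with
the `δ` of the same index. -/
theorem enabled_rep (r : Prog Ω) {n : ℕ} {e : ℕ × (Unit ⊕ Unit)} :
    r.iter.Enabled (rep n) e ↔ e.1 = n := by
  constructor
  · rintro ⟨h1, h2, h3⟩
    have hle : e.1 ≤ n := by
      rcases Nat.eq_zero_or_pos e.1 with h0 | h0
      · omega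
      · obtain ⟨a, ha, ha'⟩ := h3 {(e.1 - 1, .inl ())}
          ((r.iter_bundle_iff _ _).2 ⟨e.1 - 1, by omega, rfl⟩)
        rw [Set.mem_singleton_iff] at ha'
        subst ha'
        have := (mem_rep.1 ha).1
        simp only at this
        omega
    by_contra hne
    have hlt : e.1 < n := by omega
    obtain ⟨j, b | b⟩ := e
    · exact h1 (mem_rep.2 ⟨hlt, rfl⟩)
    · exact h2 (j, .inl ()) (mem_rep.2 ⟨hlt, rfl⟩) ((r.iter_conflict_iff _ _).2 rfl)
  · intro h
    refine ⟨fun hc => ?_, fun a ha hc => ?_, fun x hx => ?_⟩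
    · have := (mem_rep.1 hc).1
      omega
    · obtain ⟨k, b⟩ := a
      obtain ⟨h1, rfl⟩ := mem_rep.1 ha
      rw [r.iter_conflict_iff] at hc
      obtain ⟨j, b | b⟩ := e
      · exact hc
      · have hc' : k = j := hc
        simp only at h h1
        omega
    · obtain ⟨k, hk, rfl⟩ := (r.iter_bundle_iff _ _).1 hx
      exact ⟨_, mem_rep.2 ⟨by simp only; omega, rfl⟩, rfl⟩

/-- `δₙ` excludes every other `δ` and `rₙ`; later copies of `r` would need a predecessor that has
not occurred. -/
theorem not_enabled_rep_snoc_inr (r : Prog Ω) {n : ℕ} {x : Unit} {e : ℕ × (Unit ⊕ Unit)} :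
    ¬ r.iter.Enabled (rep n ++ [(n, .inr x)]) e := by
  rintro ⟨h1, h2, h3⟩
  have h4 := h2 (n, .inr x) (by simp)
  rw [r.iter_conflict_iff] at h4
  obtain ⟨j, b | b⟩ := e
  · have hne : n ≠ j := h4
    have hle : j ≤ n := by
      rcases Nat.eq_zero_or_pos j with h0 | h0
      · omega
      · obtain ⟨a, ha, ha'⟩ := h3 {(j - 1, .inl ())}
          ((r.iter_bundle_iff _ _).2 ⟨j - 1, by simp only; omega, rfl⟩)
        rw [Set.mem_singleton_iff] at ha'
        subst ha'
        rw [List.mem_append] at ha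
        rcases ha with ha | ha
        · have := (mem_rep.1 ha).1
          simp only at this
          omega
        · simp at ha
    exact h1 (List.mem_append_left _ (mem_rep.2 ⟨by simp only; omega, rfl⟩))
  · have heq : n = j := not_not.1 h4
    subst heq
    exact h1 (by simp)

theorem isTrace_rep (r : Prog Ω) (n : ℕ) : r.iter.IsTrace (rep n) := by
  induction n with
  | zero => exact .nil
  | succ n ih => rw [rep_succ]; exact .snoc _ _ ih ((enabled_rep r).2 rfl)

theorem isTrace_rep_snoc (r : Prog Ω) {n : ℕ} {e : ℕ × (Unit ⊕ Unit)} :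
    r.iter.IsTrace (rep n ++ [e]) ↔ e.1 = n := by
  rw [isTrace_snoc, enabled_rep, and_iff_right (isTrace_rep r n)]

theorem isMaxTrace_rep_snoc_inr (r : Prog Ω) (n : ℕ) (x : Unit) :
    r.iter.IsMaxTrace (rep n ++ [(n, .inr x)]) :=
  ⟨(isTrace_rep_snoc r).2 rfl, fun _ h => not_enabled_rep_snoc_inr r (isTrace_snoc.1 h).2⟩

theorem not_isMaxTrace_rep (r : Prog Ω) (n : ℕ) : ¬ r.iter.IsMaxTrace (rep n) :=
  fun h => h.2 (n, .inl ()) ((isTrace_rep_snoc r).2 rfl)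

theorem isWeaklyMaxTrace_rep (r : Prog Ω) (n : ℕ) : r.iter.IsWeaklyMaxTrace (rep n) := by
  refine ⟨isTrace_rep r n, [(n, .inr ())], isMaxTrace_rep_snoc_inr r n (), fun e he => ?_⟩
  rw [List.mem_singleton] at he
  subst he
  exact fun _ => subset_rfl

theorem eq_rep_of_isTrace (r : Prog Ω) {β : List (ℕ × (Unit ⊕ Unit))} (h : r.iter.IsTrace β) :
    β = rep (repCount β) ∨ β = rep (repCount β) ++ [(repCount β, .inr ())] := by
  suffices h : ∃ n, β = rep n ∨ β = rep n ++ [(n, .inr ())] by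
    obtain ⟨n, rfl | rfl⟩ := h
    · exact Or.inl (by rw [repCount_rep])
    · exact Or.inr (by rw [repCount_snoc_inr, repCount_rep])
  induction h with
  | nil => exact ⟨0, Or.inl rfl⟩
  | snoc α e _ he ih =>
    obtain ⟨n, rfl | rfl⟩ := ih
    · obtain ⟨j, b | b⟩ := e
      · obtain rfl : j = n := (enabled_rep r).1 he
        exact ⟨j + 1, Or.inl (rep_succ j).symm⟩
      · obtain rfl : j = n := (enabled_rep r).1 he
        exact ⟨j, Or.inr rfl⟩
    · exact absurd he (not_enabled_rep_snoc_inr r)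

theorem finite_isTrace_repCount_le (r : Prog Ω) (n : ℕ) :
    {β | r.iter.IsTrace β ∧ repCount β ≤ n}.Finite := by
  refine (((Set.finite_Iic n).image rep).union
    ((Set.finite_Iic n).image fun k => rep k ++ [(k, .inr ())])).subset ?_
  rintro β ⟨h1, h2⟩
  rcases eq_rep_of_isTrace r h1 with h | h
  · exact Or.inl ⟨_, h2, h.symm⟩
  · exact Or.inr ⟨_, h2, h.symm⟩

/-- The events of the left operand in a list of events. -/
def lefts (γ : List (E ⊕ F)) : List E := γ.filterMap Sum.getLeft?

/-- The events of the right operand in a list of events. -/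
def rights (γ : List (E ⊕ F)) : List F := γ.filterMap Sum.getRight?

@[simp] theorem lefts_nil : lefts ([] : List (E ⊕ F)) = [] := rfl
@[simp] theorem rights_nil : rights ([] : List (E ⊕ F)) = [] := rfl
@[simp] theorem lefts_append (γ γ' : List (E ⊕ F)) : lefts (γ ++ γ') = lefts γ ++ lefts γ' := by
  simp [lefts]
@[simp] theorem rights_append (γ γ' : List (E ⊕ F)) :
    rights (γ ++ γ') = rights γ ++ rights γ' := by
  simp [rights]
@[simp] theorem lefts_inl (e : E) (γ : List (E ⊕ F)) : lefts (.inl e :: γ) = e :: lefts γ := rfl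
@[simp] theorem lefts_inr (e : F) (γ : List (E ⊕ F)) : lefts (.inr e :: γ) = lefts γ := rfl
@[simp] theorem rights_inl (e : E) (γ : List (E ⊕ F)) : rights (.inl e :: γ) = rights γ := rfl
@[simp] theorem rights_inr (e : F) (γ : List (E ⊕ F)) : rights (.inr e :: γ) = e :: rights γ := rfl

theorem mem_lefts {γ : List (E ⊕ F)} {e : E} : e ∈ lefts γ ↔ .inl e ∈ γ := by
  simp [lefts, Sum.getLeft?_eq_some_iff]

theorem mem_rights {γ : List (E ⊕ F)} {e : F} : e ∈ rights γ ↔ .inr e ∈ γ := by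
  simp [rights, Sum.getRight?_eq_some_iff]

variable {A : EventStructure Ω E} {B : EventStructure Ω F}

theorem enabled_par_inl {γ : List (E ⊕ F)} {e : E} :
    (A.par B).Enabled γ (.inl e) ↔ A.Enabled (lefts γ) e := by
  refine and_congr (not_congr mem_lefts.symm) (and_congr ⟨fun h a ha => h _ (mem_lefts.1 ha), ?_⟩
    ⟨fun h x hx => ?_, ?_⟩)
  · rintro h (a | a) ha
    · exact h a (mem_lefts.2 ha)
    · exact id
  · obtain ⟨_, ha, a, hax, rfl⟩ := h _ (.inl x e hx)
    exact ⟨a, mem_lefts.2 ha, hax⟩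
  · rintro h _ ⟨x, _, hx⟩
    obtain ⟨a, ha, hax⟩ := h x hx
    exact ⟨_, mem_lefts.1 ha, a, hax, rfl⟩

theorem enabled_par_inr {γ : List (E ⊕ F)} {e : F} :
    (A.par B).Enabled γ (.inr e) ↔ B.Enabled (rights γ) e := by
  refine and_congr (not_congr mem_rights.symm) (and_congr ⟨fun h a ha => h _ (mem_rights.1 ha), ?_⟩
    ⟨fun h x hx => ?_, ?_⟩)
  · rintro h (a | a) ha
    · exact id
    · exact h a (mem_rights.2 ha)
  · obtain ⟨_, ha, a, hax, rfl⟩ := h _ (.inr x e hx)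
    exact ⟨a, mem_rights.2 ha, hax⟩
  · intro h z hz
    cases hz with
    | inr x _ hx =>
    obtain ⟨a, ha, hax⟩ := h x hx
    exact ⟨_, mem_rights.1 ha, a, hax, rfl⟩

theorem isTrace_par {γ : List (E ⊕ F)} :
    (A.par B).IsTrace γ ↔ A.IsTrace (lefts γ) ∧ B.IsTrace (rights γ) := by
  induction γ using List.reverseRecOn with
  | nil => exact ⟨fun _ => ⟨.nil, .nil⟩, fun _ => .nil⟩
  | append_singleton γ e ih =>
    obtain e | e := e
    · simp [isTrace_snoc, ih, enabled_par_inl, and_right_comm]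
    · simp [isTrace_snoc, ih, enabled_par_inr, and_assoc]

theorem isMaxTrace_par {γ : List (E ⊕ F)} :
    (A.par B).IsMaxTrace γ ↔ A.IsMaxTrace (lefts γ) ∧ B.IsMaxTrace (rights γ) := by
  simp only [IsMaxTrace, Sum.forall, isTrace_par]
  constructor
  · rintro ⟨⟨h1, h2⟩, h3, h4⟩
    exact ⟨⟨h1, fun e he => h3 e (by simpa using ⟨he, h2⟩)⟩,
      ⟨h2, fun e he => h4 e (by simpa using ⟨h1, he⟩)⟩⟩
  · rintro ⟨⟨h1, h2⟩, h3, h4⟩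
    exact ⟨⟨h1, h3⟩, fun e he => h2 e (by simpa using he.1), fun e he => h4 e (by simpa using he.2)⟩

theorem lefts_map_inl (α : List E) : lefts (α.map (Sum.inl (β := F))) = α := by
  induction α <;> simp_all

theorem rights_map_inl (α : List E) : rights (α.map (Sum.inl (β := F))) = [] := by
  induction α <;> simp_all

theorem lefts_map_inr (α : List F) : lefts (α.map (Sum.inr (α := E))) = [] := by
  induction α <;> simp_all

theorem rights_map_inr (α : List F) : rights (α.map (Sum.inr (α := E))) = α := by
  induction α <;> simp_all

/-- There are finitely many interleavings. -/
theorem finite_lefts_rights (α : List E) (β : List F) :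
    {γ : List (E ⊕ F) | lefts γ = α ∧ rights γ = β}.Finite := by
  suffices h : ∀ n (α : List E) (β : List F), α.length + β.length ≤ n →
      {γ : List (E ⊕ F) | lefts γ = α ∧ rights γ = β}.Finite from h _ α β le_rfl
  intro n
  induction n with
  | zero =>
    intro α β h
    obtain rfl : α = [] := List.length_eq_zero_iff.1 (by omega)
    obtain rfl : β = [] := List.length_eq_zero_iff.1 (by omega)
    refine (Set.finite_singleton []).subset ?_
    rintro (_ | ⟨e | e, γ⟩) ⟨h1, h2⟩
    · rfl
    · simp at h1
    · simp at h2
  | succ n ih =>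
    intro α β h
    have hl : {γ : List (E ⊕ F) |
        ∃ e γ', γ = .inl e :: γ' ∧ lefts γ = α ∧ rights γ = β}.Finite := by
      cases α with
      | nil =>
        convert Set.finite_empty
        rw [Set.eq_empty_iff_forall_notMem]
        rintro _ ⟨e, γ, rfl, h1, -⟩
        simp at h1
      | cons a α =>
        refine ((ih α β (by simp at h; omega)).image fun γ => .inl a :: γ).subset ?_
        rintro _ ⟨e, γ, rfl, h1, h2⟩
        simp only [lefts_inl, List.cons.injEq] at h1
        exact ⟨γ, ⟨h1.2, h2⟩, by simp only; rw [h1.1]⟩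
    have hr : {γ : List (E ⊕ F) |
        ∃ e γ', γ = .inr e :: γ' ∧ lefts γ = α ∧ rights γ = β}.Finite := by
      cases β with
      | nil =>
        convert Set.finite_empty
        rw [Set.eq_empty_iff_forall_notMem]
        rintro _ ⟨e, γ, rfl, -, h1⟩
        simp at h1
      | cons b β =>
        refine ((ih α β (by simp at h; omega)).image fun γ => .inr b :: γ).subset ?_
        rintro _ ⟨e, γ, rfl, h1, h2⟩
        simp only [rights_inr, List.cons.injEq] at h2
        exact ⟨γ, ⟨h1, h2.2⟩, by simp only; rw [h2.1]⟩
    refine ((Set.finite_singleton []).union (hl.union hr)).subset ?_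
    rintro (_ | ⟨e | e, γ⟩) hγ
    · exact Or.inl rfl
    · exact Or.inr (Or.inl ⟨e, γ, rfl, hγ⟩)
    · exact Or.inr (Or.inr ⟨e, γ, rfl, hγ⟩)

theorem finite_lefts_mem_rights_mem {P : Set (List E)} {Q : Set (List F)} (hP : P.Finite)
    (hQ : Q.Finite) : {γ : List (E ⊕ F) | lefts γ ∈ P ∧ rights γ ∈ Q}.Finite := by
  refine (hP.biUnion fun α _ => hQ.biUnion fun β _ => finite_lefts_rights α β).subset ?_
  rintro γ ⟨h1, h2⟩
  exact Set.mem_biUnion h1 (Set.mem_biUnion h2 ⟨rfl, rfl⟩)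

/-! ### Simulation by `g^*` -/

/-- `k` counts the events of a trace that act as `g`; the others are ineffectual. -/
structure IsCounting (A : EventStructure Ω E) (g : Prog Ω) (k : List E → ℕ) : Prop where
  nil : k [] = 0
  step : ∀ α e, A.IsTrace (α ++ [e]) →
    (k (α ++ [e]) = k α ∧ (A.label e).Refines Prog.skip) ∨
      (k (α ++ [e]) = k α + 1 ∧ (A.label e).Refines g)
  finite : ∀ n, {α | A.IsTrace α ∧ k α ≤ n}.Finite

/-- The count is the number of copies of `g` in the image; a step mirrored by the `δ` of the star is
ineffectual. Finiteness holds because `g^*` has finitely many traces with boundedly many copies,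
each with a finite fibre. -/
theorem Sim.exists_isCounting {g : Prog Ω} (h : A.Sim g.iter) : ∃ k, IsCounting A g k := by
  obtain ⟨f, hf⟩ := h
  refine ⟨fun α => repCount (f α), by simp only [hf.map_nil]; rfl, fun α e ht => ?_, fun n => ?_⟩
  · rcases hf.step α e ht with ⟨h1, h2⟩ | ⟨⟨j, b | b⟩, h1, h2⟩
    · exact Or.inl ⟨by simp only [h1], h2⟩
    · exact Or.inr ⟨by simp only [h2, repCount_snoc_inl], h1⟩
    · exact Or.inl ⟨by simp only [h2, repCount_snoc_inr], h1⟩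
  · refine ((finite_isTrace_repCount_le g n).biUnion (t := fun β => {α | A.IsTrace α ∧ f α = β})
      fun β hβ => hf.finite_fiber β hβ.1).subset ?_
    rintro α ⟨h1, h2⟩
    exact Set.mem_biUnion (x := f α) ⟨hf.isTrace α h1, h2⟩ ⟨h1, rfl⟩

/-- Otherwise no copy of `g` could act as `r`, and all the traces `rep n` would have count 0,
against the finiteness of the counting. -/
theorem Sim.refines_of_iter {g r : Prog Ω} (h : g.iter.Sim r.iter) : g.Refines r := by
  obtain ⟨k, hk⟩ := h.exists_isCounting
  by_contra hgr
  have h0 : ∀ n, k (rep n) = 0 := by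
    intro n
    induction n with
    | zero => exact hk.nil
    | succ n ih =>
      rw [rep_succ]
      rcases hk.step (rep n) (n, .inl ()) ((isTrace_rep_snoc g).2 rfl) with ⟨h1, -⟩ | ⟨-, h1⟩
      · rw [h1, ih]
      · exact absurd h1 hgr
  refine Set.infinite_of_injective_forall_mem (f := rep) (s := {α | g.iter.IsTrace α ∧ k α ≤ 0})
    (fun a b hab => ?_) (fun n => ⟨isTrace_rep g n, (h0 n).le⟩) (hk.finite 0)
  simpa [length_rep] using congrArg List.length hab

open Classical in
/-- The concurrent composition of two structures that act as `g` and as `g'` is simulated by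
`h^*` if `h` can act as both. -/
theorem par_sim_iter {g g' h : Prog Ω} {k : List E → ℕ} {k' : List F → ℕ} (hk : IsCounting A g k)
    (hk' : IsCounting B g' k') (hg : g.Refines h) (hg' : g'.Refines h) :
    (A.par B).Sim h.iter := by
  obtain ⟨N, hN⟩ : ∃ N : List (E ⊕ F) → ℕ, ∀ γ, N γ = k (lefts γ) + k' (rights γ) :=
    ⟨_, fun _ => rfl⟩
  have hN0 : N [] = 0 := by simp [hN, hk.nil, hk'.nil]
  have hstep : ∀ γ e, (A.par B).IsTrace (γ ++ [e]) →
      (N (γ ++ [e]) = N γ ∧ ((A.par B).label e).Refines Prog.skip) ∨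
        (N (γ ++ [e]) = N γ + 1 ∧ ((A.par B).label e).Refines h) := by
    rintro γ (e | e) ht
    · have ht' := (isTrace_par.1 ht).1
      simp only [lefts_append, lefts_inl, lefts_nil] at ht'
      rcases hk.step _ _ ht' with ⟨h1, h2⟩ | ⟨h1, h2⟩
      · exact Or.inl ⟨by simp [hN, h1], h2⟩
      · exact Or.inr ⟨by simp [hN, h1]; omega, fun s => (h2 s).trans (hg s)⟩
    · have ht' := (isTrace_par.1 ht).2
      simp only [rights_append, rights_inr, rights_nil] at ht'
      rcases hk'.step _ _ ht' with ⟨h1, h2⟩ | ⟨h1, h2⟩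
      · exact Or.inl ⟨by simp [hN, h1], h2⟩
      · exact Or.inr ⟨by simp [hN, h1]; omega, fun s => (h2 s).trans (hg' s)⟩
  -- The last event of a maximal trace may not be dropped; if it is ineffectual, the closing `δ`
  -- mirrors it. The condition `γ ≠ []` matters because `[].dropLast = []`: an empty maximal trace
  -- must still go to `[]`.
  let f : List (E ⊕ F) → List (ℕ × (Unit ⊕ Unit)) := fun γ =>
    if (A.par B).IsMaxTrace γ ∧ γ ≠ [] ∧ N γ = N γ.dropLast then rep (N γ) ++ [(N γ, .inr ())]
    else rep (N γ)
  have hf1 : ∀ γ, ¬ (A.par B).IsMaxTrace γ → f γ = rep (N γ) := fun γ hγ =>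
    if_neg fun hc => hγ hc.1
  have hf2 : ∀ γ e, N (γ ++ [e]) = N γ + 1 → f (γ ++ [e]) = rep (N γ) ++ [(N γ, .inl ())] :=
    fun γ e he => by
      rw [← rep_succ, ← he]
      exact if_neg fun hc => by simp [he] at hc
  have hf3 : ∀ γ e, (A.par B).IsMaxTrace (γ ++ [e]) → N (γ ++ [e]) = N γ →
      f (γ ++ [e]) = rep (N γ) ++ [(N γ, .inr ())] := fun γ e hm he => by
    rw [← he]
    exact if_pos ⟨hm, by simp, by simpa using he⟩
  refine ⟨f, fun γ _ => ?_, ?_, fun β _ => ?_, fun γ e ht => ?_, fun γ e hm => ?_⟩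
  · simp only [f]
    split_ifs
    · exact (isTrace_rep_snoc h).2 rfl
    · exact isTrace_rep h _
  · have hnil : f [] = rep (N []) := if_neg fun hc => hc.2.1 rfl
    rw [hnil, hN0]
    rfl
  · refine (finite_lefts_mem_rights_mem (hk.finite β.length) (hk'.finite β.length)).subset ?_
    rintro γ ⟨ht, rfl⟩
    have hle : N γ ≤ (f γ).length := by
      simp only [f]
      split_ifs <;> simp [length_rep]
    rw [hN] at hle
    obtain ⟨h1, h2⟩ := isTrace_par.1 ht
    exact ⟨⟨h1, by omega⟩, ⟨h2, by omega⟩⟩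
  · rw [hf1 γ fun hc => hc.2 e ht]
    rcases hstep γ e ht with ⟨h1, h2⟩ | ⟨h1, h2⟩
    · by_cases hm : (A.par B).IsMaxTrace (γ ++ [e])
      · exact Or.inr ⟨(N γ, .inr ()), h2, hf3 γ e hm h1⟩
      · exact Or.inl ⟨by rw [hf1 _ hm, h1], h2⟩
    · exact Or.inr ⟨(N γ, .inl ()), h2, hf2 γ e h1⟩
  · rw [hf1 γ fun hc => hc.2 e hm.1]
    rcases hstep γ e hm.1 with ⟨h1, h2⟩ | ⟨h1, h2⟩
    · refine ⟨⟨(N γ, .inr ()), h2, hf3 γ e hm h1⟩, ?_⟩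
      rw [hf3 γ e hm h1]
      have := isMaxTrace_rep_snoc_inr h (N γ) ()
      exact ⟨this.1, [], by simpa using this, by simp⟩
    · refine ⟨⟨(N γ, .inl ()), h2, hf2 γ e h1⟩, ?_⟩
      rw [hf2 γ e h1, ← rep_succ]
      exact isWeaklyMaxTrace_rep h _

end Traces

end EventStructure

end RelyGuarantee

namespace RelyGuarantee

namespace EventStructure

section Environment

variable {Ω : Type*} [Fintype Ω] {E F X : Type*}

/-! ### Replacing a component by its environment -/

/-- The events by which `r₁^* ‖ A` mirrors an event of `(r^* ‖ A) ‖ B` after the trace `γ`, which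
has been mirrored by `β`; here `k` counts the events of a trace of `B` that act as `r₁`. -/
def mirrorStep (k : List F → ℕ) (γ : List (((ℕ × (Unit ⊕ Unit)) ⊕ E) ⊕ F))
    (β : List ((ℕ × (Unit ⊕ Unit)) ⊕ E)) :
    ((ℕ × (Unit ⊕ Unit)) ⊕ E) ⊕ F → List ((ℕ × (Unit ⊕ Unit)) ⊕ E)
  | .inl (.inl (_, .inl _)) => [.inl ((lefts β).length, .inl ())]
  | .inl (.inl (_, .inr _)) => []
  | .inl (.inr e) => [.inr e]
  | .inr e => if k (rights γ ++ [e]) = k (rights γ) then [] else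
      [.inl ((lefts β).length, .inl ())]

/-- The map of traces from `(r^* ‖ A) ‖ B` to `r₁^* ‖ A` that mirrors the effectual events of `B` by
copies of `r₁`. -/
def mirror (k : List F → ℕ) (γ : List (((ℕ × (Unit ⊕ Unit)) ⊕ E) ⊕ F)) :
    List ((ℕ × (Unit ⊕ Unit)) ⊕ E) :=
  List.reverseRecOn γ [] fun γ e β => β ++ mirrorStep k γ β e

theorem mirror_nil (k : List F → ℕ) :
    mirror k ([] : List (((ℕ × (Unit ⊕ Unit)) ⊕ E) ⊕ F)) = [] := by
  simp [mirror]

theorem mirror_snoc (k : List F → ℕ) (γ : List (((ℕ × (Unit ⊕ Unit)) ⊕ E) ⊕ F))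
    (e : ((ℕ × (Unit ⊕ Unit)) ⊕ E) ⊕ F) :
    mirror k (γ ++ [e]) = mirror k γ ++ mirrorStep k γ (mirror k γ) e := by
  simp [mirror]

variable {A : EventStructure Ω E} {B : EventStructure Ω F}

theorem rights_mirror (k : List F → ℕ) (γ : List (((ℕ × (Unit ⊕ Unit)) ⊕ E) ⊕ F)) :
    rights (mirror k γ) = rights (lefts γ) := by
  induction γ using List.reverseRecOn with
  | nil => simp [mirror_nil]
  | append_singleton γ e ih =>
    rw [mirror_snoc]
    obtain ((⟨j, x | x⟩ | e) | e) := e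
    · simp [mirrorStep, ih]
    · simp [mirrorStep, ih]
    · simp [mirrorStep, ih]
    · simp only [mirrorStep]
      split_ifs <;> simp [ih]

/-- The image uses consecutive copies of `r₁` and never the closing `δ`, which is why the length in
`mirrorStep` is the index of the next copy. -/
theorem lefts_mirror {r g : Prog Ω} {k : List F → ℕ} (hk : IsCounting B g k)
    {γ : List (((ℕ × (Unit ⊕ Unit)) ⊕ E) ⊕ F)} (hγ : ((r.iter.par A).par B).IsTrace γ) :
    lefts (mirror k γ) = rep (repCount (lefts (lefts γ)) + k (rights γ)) := by
  induction γ using List.reverseRecOn with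
  | nil => simp [mirror_nil, hk.nil]; rfl
  | append_singleton γ e ih =>
    have ih := ih (isTrace_snoc.1 hγ).1
    rw [mirror_snoc]
    obtain ((⟨j, x | x⟩ | e) | e) := e
    · simp only [mirrorStep, lefts_append, lefts_inl, lefts_nil, ih, length_rep, ← rep_succ,
        repCount_snoc_inl, rights_append, rights_inl, rights_nil, List.append_nil,
        Nat.add_right_comm]
    · simp [mirrorStep, ih, repCount_snoc_inr]
    · simp [mirrorStep, ih]
    · have ht := (isTrace_par.1 hγ).2
      simp only [rights_append, rights_inr, rights_nil] at ht
      rcases hk.step _ _ ht with ⟨h1, -⟩ | ⟨h1, -⟩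
      · simp [mirrorStep, h1, ih]
      · simp [mirrorStep, h1, ih, length_rep, ← add_assoc, rep_succ]

/-- As the `δ` of `r^*` is dropped, `r₁^*` stays able to imitate `B` however early that `δ` occurs;
the closing event restores it at the end. Fibres are finite since the image fixes the events of `A`
and bounds both counts. -/
theorem isReduction_mirror {r r₁ g : Prog Ω} {k : List F → ℕ} (hk : IsCounting B g k)
    (hr : r.Refines r₁) (hg : g.Refines r₁) :
    IsReduction ((r.iter.par A).par B) (r₁.iter.par A) (mirror k)
      fun β => .inl ((lefts β).length, .inr ()) where
  map_nil := mirror_nil k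
  isTrace γ hγ := by
    rw [isTrace_par, lefts_mirror hk hγ, rights_mirror]
    exact ⟨isTrace_rep _ _, (isTrace_par.1 (isTrace_par.1 hγ).1).2⟩
  finite_fiber β := by
    have hP := finite_lefts_mem_rights_mem (finite_isTrace_repCount_le r (lefts β).length)
      (Set.finite_singleton (rights β))
    refine (finite_lefts_mem_rights_mem hP (hk.finite (lefts β).length)).subset ?_
    rintro γ ⟨hγ, rfl⟩
    have hl := congrArg List.length (lefts_mirror hk hγ)
    rw [length_rep] at hl
    obtain ⟨h1, h2⟩ := isTrace_par.1 hγ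
    exact ⟨⟨⟨(isTrace_par.1 h1).1, by omega⟩, (rights_mirror k γ).symm⟩, h2, by omega⟩
  step γ e hγ := by
    rw [mirror_snoc]
    obtain ((⟨j, x | x⟩ | e) | e) := e
    · exact Or.inr ⟨.inl ((lefts (mirror k γ)).length, .inl ()), hr, rfl⟩
    · exact Or.inl ⟨List.append_nil _, fun _ => subset_rfl⟩
    · exact Or.inr ⟨_, fun _ => subset_rfl, rfl⟩
    · have ht := (isTrace_par.1 hγ).2
      simp only [rights_append, rights_inr, rights_nil] at ht
      rcases hk.step _ _ ht with ⟨h1, h2⟩ | ⟨h1, h2⟩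
      · exact Or.inl ⟨by simp [mirrorStep, h1], h2⟩
      · exact Or.inr ⟨.inl ((lefts (mirror k γ)).length, .inl ()),
          fun s => (h2 s).trans (hg s), by simp [mirrorStep, h1]⟩
  not_isMaxTrace γ hγ hm := by
    rw [isMaxTrace_par, lefts_mirror hk hγ] at hm
    exact not_isMaxTrace_rep _ _ hm.1
  isMaxTrace_snoc γ hγ := by
    refine ⟨?_, fun _ => subset_rfl⟩
    rw [isMaxTrace_par]
    simp only [lefts_append, lefts_inl, lefts_nil, rights_append, rights_inl, rights_nil,
      List.append_nil, rights_mirror, lefts_mirror hk hγ.1, length_rep]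
    exact ⟨isMaxTrace_rep_snoc_inr _ _ _, (isMaxTrace_par.1 (isMaxTrace_par.1 hγ).1).2⟩

/-- `q` identifies the events of two structures with the same traces and labels. -/
structure IsRelabelling (C : EventStructure Ω X) (A : EventStructure Ω E) (q : X ≃ E) : Prop where
  isTrace_iff : ∀ α, C.IsTrace α ↔ A.IsTrace (α.map q)
  label_eq : ∀ e, C.label e = A.label (q e)

theorem IsRelabelling.isMaxTrace_iff {C : EventStructure Ω X} {q : X ≃ E}
    (h : IsRelabelling C A q) (α : List X) : C.IsMaxTrace α ↔ A.IsMaxTrace (α.map q) := by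
  refine and_congr (h.isTrace_iff α) (q.forall_congr fun e => ?_)
  rw [h.isTrace_iff]
  simp

theorem IsReduction.comp_relabelling {C : EventStructure Ω X} {q : X ≃ E} {f : List E → List F}
    {d : List F → F} (hf : IsReduction A B f d) (h : IsRelabelling C A q) :
    IsReduction C B (fun α => f (α.map q)) d where
  map_nil := hf.map_nil
  isTrace α hα := hf.isTrace _ ((h.isTrace_iff α).1 hα)
  finite_fiber β := by
    refine ((hf.finite_fiber β).preimage (f := List.map q)
      (List.map_injective_iff.2 q.injective).injOn).subset ?_
    rintro α ⟨h1, h2⟩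
    exact ⟨(h.isTrace_iff α).1 h1, h2⟩
  step α e hα := by
    rw [h.isTrace_iff] at hα
    simp only [List.map_append, List.map_cons, List.map_nil, h.label_eq] at hα ⊢
    exact hf.step _ _ hα
  not_isMaxTrace α hα := hf.not_isMaxTrace _ ((h.isTrace_iff α).1 hα)
  isMaxTrace_snoc α hα := hf.isMaxTrace_snoc _ ((h.isMaxTrace_iff α).1 hα)

/-- If `C` is `(r^* ‖ A) ‖ B` up to the names of the events and has a terminating scheduler, then
`r₁^* ‖ A` never gets stuck. -/
theorem exists_isTrace_snoc_of_isTerminatingScheduler {C : EventStructure Ω X} {r r₁ : Prog Ω}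
    {q : X ≃ ((ℕ × (Unit ⊕ Unit)) ⊕ E) ⊕ F} (h : IsRelabelling C ((r.iter.par A).par B) q)
    (hr₁ : r₁.IsProgram) {σ : List X → X → Ω → Ω → ℝ} (hσ : C.IsTerminatingScheduler σ)
    {β : List ((ℕ × (Unit ⊕ Unit)) ⊕ E)} (hβ : (r₁.iter.par A).IsTrace β)
    (hβm : ¬ (r₁.iter.par A).IsMaxTrace β) (t : Ω) :
    ∃ e, (r₁.iter.par A).IsTrace (β ++ [e]) ∧ (((r₁.iter.par A).label e).out t).Nonempty := by
  obtain ⟨h1, h2⟩ := isTrace_par.1 hβ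
  -- While the star is open, a further copy of the program `r₁` is possible. Once it is closed, the
  -- move has to come from `A`.
  rcases eq_rep_of_isTrace r₁ h1 with h3 | h3
  · refine ⟨.inl (repCount (lefts β), .inl ()), isTrace_par.2 ⟨?_, by simpa using h2⟩, hr₁ t⟩
    rw [h3]
    simp only [lefts_append, lefts_inl, lefts_nil]
    rw [h3, isTrace_rep_snoc]
    simp only [repCount_rep]
  have hAm : ¬ A.IsMaxTrace (rights β) := fun hc => hβm <| isMaxTrace_par.2
    ⟨h3 ▸ isMaxTrace_rep_snoc_inr r₁ _ (), hc⟩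
  -- Without maximal traces the behaviour would be 0, not a distribution. The maximal trace provides
  -- a completed trace `b` of `B`.
  obtain ⟨γ, hγ⟩ : ∃ γ, C.IsMaxTrace γ := by
    by_contra hc
    have : IsEmpty {γ // C.IsMaxTrace γ} := ⟨fun γ => hc ⟨γ.1, γ.2⟩⟩
    have h4 := (hσ.2 t).2
    simp [behaviour] at h4
  rw [h.isMaxTrace_iff, isMaxTrace_par] at hγ
  set b := rights (γ.map q)
  -- A history of `C` in which the star is closed at once and `B` has finished, so that `σ` can only
  -- schedule an event of `A`. Its positive weight shows that the label is nonempty at `t`.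
  let δ : List (((ℕ × (Unit ⊕ Unit)) ⊕ E) ⊕ F) :=
    .inl (.inl (0, .inr ())) :: ((rights β).map fun e => .inl (.inr e)) ++ b.map .inr
  have hmap : lefts ((rights β).map fun e =>
      (Sum.inl (.inr e) : ((ℕ × (Unit ⊕ Unit)) ⊕ E) ⊕ F)) = (rights β).map .inr := by
    simpa [Function.comp_def] using lefts_map_inl (F := F) ((rights β).map Sum.inr)
  have hmap' : rights ((rights β).map fun e =>
      (Sum.inl (.inr e) : ((ℕ × (Unit ⊕ Unit)) ⊕ E) ⊕ F)) = [] := by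
    simpa [Function.comp_def] using rights_map_inl (F := F)
      ((rights β).map (Sum.inr (α := ℕ × (Unit ⊕ Unit))))
  have hδll : lefts (lefts δ) = [(0, .inr ())] := by
    simp [δ, hmap, lefts_map_inr]
  have hδlr : rights (lefts δ) = rights β := by
    simp [δ, hmap, lefts_map_inr, rights_map_inr]
  have hδr : rights δ = b := by
    simp [δ, hmap', rights_map_inr]
  have hskip : r.iter.IsMaxTrace [(0, .inr ())] := isMaxTrace_rep_snoc_inr r 0 ()
  have hδ : C.IsTrace (δ.map q.symm) := by
    rw [h.isTrace_iff, List.map_map, Equiv.self_comp_symm, List.map_id, isTrace_par, isTrace_par,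
      hδll, hδlr, hδr]
    exact ⟨⟨hskip.1, h2⟩, hγ.2.1⟩
  have hδm : ¬ C.IsMaxTrace (δ.map q.symm) := by
    rw [h.isMaxTrace_iff, List.map_map, Equiv.self_comp_symm, List.map_id, isMaxTrace_par,
      isMaxTrace_par, hδlr]
    exact fun hc => hAm hc.1.2
  obtain ⟨w, hw0, hw1, hw2⟩ := hσ.1.exists_weight
  obtain ⟨e, he⟩ : ∃ e, w (δ.map q.symm) e t ≠ 0 := by
    by_contra! hc
    have := hw2 _ hδ hδm t
    simp only [hc] at this
    exact zero_ne_one (hasSum_zero.unique this)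
  have hte : C.IsTrace (δ.map q.symm ++ [e]) := by
    by_contra hc
    exact he (hw0 _ _ t hc)
  have hne : ((C.label e).out t).Nonempty := by
    obtain ⟨-, ⟨μ, hμ, -⟩ | h5⟩ := hw1 (δ.map q.symm) e t
    · exact ⟨μ, hμ⟩
    · exact absurd h5.1 he
  rw [h.label_eq] at hne
  rw [h.isTrace_iff, List.map_append, List.map_map, Equiv.self_comp_symm, List.map_id] at hte
  simp only [List.map_cons, List.map_nil] at hte
  generalize q e = e' at hne hte
  rw [isTrace_par, isTrace_par] at hte
  obtain ((i | e') | e') := e'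
  · refine absurd hte.1.1 ?_
    simp only [lefts_append, lefts_inl, lefts_nil, hδll]
    exact hskip.2 _
  · refine ⟨.inr e', isTrace_par.2 ⟨by simpa using h1, ?_⟩, hne⟩
    simpa [hδlr] using hte.1.2
  · refine absurd hte.2 ?_
    simp only [rights_append, rights_inr, rights_nil, hδr]
    exact hγ.2.2 _

theorem le_prob_behaviour_of_semGe {C : EventStructure Ω X} {r r₁ g : Prog Ω} {k : List F → ℕ}
    {q : X ≃ ((ℕ × (Unit ⊕ Unit)) ⊕ E) ⊕ F} (h : IsRelabelling C ((r.iter.par A).par B) q)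
    (hr₁ : r₁.IsProgram) (hk : IsCounting B g k) (hr : r.Refines r₁) (hg : g.Refines r₁)
    {σ : List X → X → Ω → Ω → ℝ} (hσ : C.IsTerminatingScheduler σ) {s₀ : Ω} {O : Set Ω} {p : ℝ}
    (hp : (r₁.iter.par A).SemGe s₀ O p) : p ≤ prob (C.behaviour σ s₀) O :=
  ((isReduction_mirror hk hr hg).comp_relabelling h).le_prob_behaviour
    (fun _ hβ hβm t => exists_isTrace_snoc_of_isTerminatingScheduler h hr₁ hσ hβ hβm t) hσ hp

/-- The exchange of the last two operands of `(Y ‖ A) ‖ B`. -/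
def swapLast (Y E F : Type*) : (Y ⊕ E) ⊕ F ≃ (Y ⊕ F) ⊕ E :=
  (Equiv.sumAssoc Y E F).trans (((Equiv.refl Y).sumCongr (Equiv.sumComm E F)).trans
    (Equiv.sumAssoc Y F E).symm)

theorem isRelabelling_refl (A : EventStructure Ω E) : IsRelabelling A A (Equiv.refl E) :=
  ⟨fun α => by simp, fun _ => rfl⟩

/-- With the last two operands exchanged, the bound for one component also serves for the other. -/
theorem isRelabelling_swapLast {Y : Type*} (C : EventStructure Ω Y) :
    IsRelabelling ((C.par A).par B) ((C.par B).par A) (swapLast Y E F) where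
  isTrace_iff γ := by
    have h1 : lefts (lefts (γ.map (swapLast Y E F))) = lefts (lefts γ) ∧
        rights (lefts (γ.map (swapLast Y E F))) = rights γ ∧
        rights (γ.map (swapLast Y E F)) = rights (lefts γ) := by
      induction γ with
      | nil => exact ⟨rfl, rfl, rfl⟩
      | cons e γ ih =>
        obtain ⟨h1, h2, h3⟩ := ih
        obtain ((e | e) | e) := e <;> simp [swapLast] at h1 h2 h3 ⊢ <;> simp [h1, h2, h3]
    simp only [isTrace_par, h1]
    tauto
  label_eq e := by obtain ((e | e) | e) := e <;> rfl

end Environment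

/-! ### Lower bounds on closed convex hulls and intersections -/

section Bounds

variable {Ω : Type*} [Fintype Ω] {E : Type*}

theorem continuous_prob (O : Set Ω) : Continuous fun μ : Ω → ℝ => prob μ O := by
  classical
  simp only [prob_eq]
  refine continuous_finsetSum _ fun u _ => ?_
  split_ifs
  · exact continuous_apply u
  · exact continuous_const

theorem convex_le_prob (O : Set Ω) (p : ℝ) : Convex ℝ {μ : Ω → ℝ | p ≤ prob μ O} := by
  classical
  refine convex_halfSpace_ge (f := fun μ : Ω → ℝ => prob μ O) ⟨fun μ μ' => ?_, fun c μ => ?_⟩ p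
  · simp only [prob_eq, ← Finset.sum_add_distrib]
    exact Finset.sum_congr rfl fun u _ => by split_ifs <;> simp
  · simp only [prob_eq, smul_eq_mul, Finset.mul_sum]
    exact Finset.sum_congr rfl fun u _ => by split_ifs <;> simp

/-- The lower bound defines a closed half-space, which contains the closed convex hull once it
contains the generators. -/
theorem semGe_of_forall {A : EventStructure Ω E} {s : Ω} {O : Set Ω} {p : ℝ}
    (h : ∀ σ, A.IsTerminatingScheduler σ → p ≤ prob (A.behaviour σ s) O) : A.SemGe s O p := by
  have hcl : IsClosed {μ : Ω → ℝ | p ≤ prob μ O} := isClosed_le continuous_const (continuous_prob O)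
  refine fun μ hμ => closure_minimal (convexHull_min ?_ (convex_le_prob O p)) hcl hμ
  rintro _ ⟨σ, hσ, rfl⟩
  exact h σ hσ

theorem prob_inter_ge {μ : Ω → ℝ} (hμ : μ ∈ stdSimplex ℝ Ω) (O O' : Set Ω) :
    prob μ O + prob μ O' - 1 ≤ prob μ (O ∩ O') := by
  classical
  rw [← hμ.2, prob_eq, prob_eq, prob_eq,
    ← Finset.sum_add_distrib, ← Finset.sum_sub_distrib]
  refine Finset.sum_le_sum fun u _ => ?_
  have := hμ.1 u
  by_cases h : u ∈ O <;> by_cases h' : u ∈ O' <;> simp [h, h', this]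

end Bounds

end EventStructure

end RelyGuarantee

theorem propositionp1605 {Ω : Type*} [Fintype Ω] {Ev₁ Ev₂ : Type*}
    (E₁ : RelyGuarantee.EventStructure Ω Ev₁) (E₂ : RelyGuarantee.EventStructure Ω Ev₂)
    (r₁ r₂ g g' : RelyGuarantee.Prog Ω)
    (hr₁ : r₁.IsProgram) (hr₂ : r₂.IsProgram) (hg : g.IsProgram) (hg' : g'.IsProgram)
    (s₀ : Ω) (O₁ O₂ : Set Ω) (p₁ p₂ : ℝ)
    (h₁ : (r₁.iter.par E₁).SemGe s₀ O₁ p₁)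
    (h₂ : (r₂.iter.par E₂).SemGe s₀ O₂ p₂)
    (hE₁ : E₁.Sim g.iter) (hgr : g.iter.Sim r₂.iter)
    (hE₂ : E₂.Sim g'.iter) (hgr' : g'.iter.Sim r₁.iter) :
    (((r₁.inter r₂).iter.par E₁).par E₂).SemGe s₀ (O₁ ∩ O₂) (p₁ + p₂ - 1) ∧
      (E₁.par E₂).Sim (g.choice g').iter := by
  obtain ⟨k₁, hk₁⟩ := hE₁.exists_isCounting
  obtain ⟨k₂, hk₂⟩ := hE₂.exists_isCounting
  constructor
  · refine RelyGuarantee.EventStructure.semGe_of_forall fun σ hσ => ?_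
    have h3 := RelyGuarantee.EventStructure.le_prob_behaviour_of_semGe
      (RelyGuarantee.EventStructure.isRelabelling_refl _) hr₁ hk₂
      (fun s => Set.inter_subset_left) hgr'.refines_of_iter hσ h₁
    have h4 := RelyGuarantee.EventStructure.le_prob_behaviour_of_semGe
      (RelyGuarantee.EventStructure.isRelabelling_swapLast _) hr₂ hk₁
      (fun s => Set.inter_subset_right) hgr.refines_of_iter hσ h₂
    have h5 := RelyGuarantee.EventStructure.prob_inter_ge (hσ.2 s₀) O₁ O₂
    linarith
  · refine RelyGuarantee.EventStructure.par_sim_iter hk₁ hk₂ (fun s μ hμ => ?_) fun s μ hμ => ?_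
    · obtain ⟨μ', hμ'⟩ := hg' s
      -- Each summand refines the choice with the other at weight 0, but some member of the other is
      -- still required; here the programs must be nonempty.
      exact ⟨0, by simp, μ, hμ, μ', hμ', by simp⟩
    · obtain ⟨μ', hμ'⟩ := hg s
      exact ⟨1, by simp, μ', hμ', μ, hμ, by simp⟩
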